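/- Let $\mathfrak g$ be a real split simple Lie algebra with Killing form $K$, split Cartan subalgebra $\mathfrak a$, $n=\dim\mathfrak a$, and a system $P$ of simple roots. For $\alpha\in P$ choose root vectors $e_{\alpha}\in\mathfrak g_{\alpha}$, $e_{-\alpha}\in\mathfrak g_{-\alpha}$ with $K(e_\alpha,e_{-\alpha})=1$, and constants $a_\alpha\in\mathbb R$. Fix a basis $\{h_i\}$ of $\mathfrak a$ with Killing-dual basis $\{h_i'\}$. On $\mathbb R^{2n}$ with coordinates $(p_i,q_i)$ and the bracket $\{p_i,p_j\}=\{q_i,q_j\}=0$, $\{p_i,q_j\}=\delta_{ij}$, put $p=\sum p_ih_i$, $q=\sum q_ih_i'\in\mathfrak a$. The generalised Toda lattice has the Hamiltonian $$H=\tfrac12K(p,p)+\sum_{\alpha\in P}a_\alpha e^{\alpha(q)},$$ whose trajectories are the solutions of $\dot q_i=\partial H/\partial p_i$, $\dot p_i=-\partial H/\partial q_i$, and the Lax matrices $$L=p+\sum_{\alpha\in P}a_\alpha e^{\alpha(q)}e_{-\alpha}+\sum_{\alpha\in P}e_\alpha,\qquad L_-=-\sum_{\alpha\in P}a_\alpha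 e^{\alpha(q)}e_{-\alpha}.$$ Let $\beta\in P$ with $a_\beta\neq0$, let $b\in\mathbb R$, and put $$d\tilde t=e^{\beta(q)}dt,\qquad \tilde H=e^{-\beta(q)}(H+b),\qquad \tilde L=L-\tilde H\,\frac{e_\beta}{a_\beta},\qquad \tilde L_-=e^{-\beta(q)}L_-.$$ Then the following hold. 1. (Canonical change of time.) The form $\sum p_i\,dq_i-H\,dt$ of the extended phase space is preserved up to an exact form: $\sum p_i\,dq_i-\tilde H\,d\tilde t=\sum p_i\,dq_i-H\,dt-b\,dt$. The time change $d\tilde t=e^{\beta(q)}dt$ identifies the trajectories of the Toda lattice on the surface $H=-b$ with the trajectories of $\tilde H$ on the surface $\tilde H=0$. More generally, for every $E\in\mathbb R$ it identifies the trajectories on the energy surface $-b$ of the Toda lattice with $a_\beta$ replaced by $a_\beta-E$ with the trajectories of $\tilde H$ on the surface $\tilde H=E$. 2. (Integrability.) The Hamiltonian $\tilde H$ is completely integrable. There are $n$ smooth functions on $\mathbb R^{2n}$ in involution, with linearly independent differentials on an open dense set, one of which is $\tilde H$, while each of the other $n-1$ has the form $\varphi\circ\tilde L$ with $\varphi$ an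 $\mathrm{ad}$-invariant polynomial on $\mathfrak g$. 3. (Lax equation.) $\{\tilde H,\tilde L\}=[\tilde L,\tilde L_-]$. 4. (New integrals.) For every invariant polynomial $\varphi$ on $\mathfrak g$ its restriction $\varphi\circ\tilde L$ to the shifted orbit, i.e. to the points $\tilde L(p,q)$, is a smooth integral of motion: $\{\tilde H,\varphi\circ\tilde L\}=0$. For any two invariant polynomials $\varphi,\psi$, $\{\varphi\circ\tilde L,\psi\circ\tilde L\}=0$. -/

import Mathlib

open scoped ContDiff

noncomputable section

/-! ### Canonical phase space -/

/-- The phase space `ℝ²ⁿ`. A point is a pair `(p, q)`: momenta first, coordinates second. -/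
abbrev PhaseSpace (ι : Type*) : Type _ := (ι → ℝ) × (ι → ℝ)

section Hamiltonian

variable {ι : Type*} [Fintype ι] [DecidableEq ι]

/-- `∂F/∂pᵢ`. -/
def partialP (F : PhaseSpace ι → ℝ) (i : ι) (z : PhaseSpace ι) : ℝ :=
  fderiv ℝ F z (Pi.single i 1, 0)

/-- `∂F/∂qᵢ`. -/
def partialQ (F : PhaseSpace ι → ℝ) (i : ι) (z : PhaseSpace ι) : ℝ :=
  fderiv ℝ F z (0, Pi.single i 1)

/-- The canonical Poisson bracket, normalised by `{pᵢ, qⱼ} = δᵢⱼ`. -/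
def poisson (F G : PhaseSpace ι → ℝ) (z : PhaseSpace ι) : ℝ :=
  ∑ i, (partialP F i z * partialQ G i z - partialQ F i z * partialP G i z)

/-- The bracket `{F, X}` of a function with a map into a finite-dimensional vector space, taken
coordinate by coordinate (the result does not depend on the basis that is used). -/
def poissonVec {V : Type*} [AddCommGroup V] [Module ℝ V] [FiniteDimensional ℝ V]
    (F : PhaseSpace ι → ℝ) (X : PhaseSpace ι → V) (z : PhaseSpace ι) : V :=
  ∑ k, poisson F (fun w => (Module.finBasis ℝ V).repr (X w) k) z • Module.finBasis ℝ V k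

/-- Hamilton's equations `q̇ᵢ = ∂F/∂pᵢ`, `ṗᵢ = -∂F/∂qᵢ` along the curve `γ` at the time `t`. -/
def SolvesHamilton (F : PhaseSpace ι → ℝ) (γ : ℝ → PhaseSpace ι) (t : ℝ) : Prop :=
  ∀ i, HasDerivAt (fun s => (γ s).2 i) (partialP F i (γ t)) t ∧
    HasDerivAt (fun s => (γ s).1 i) (-partialQ F i (γ t)) t

/-- The form `∑ pᵢ dqᵢ - F dt` of the extended phase space on the surface where the momentum
conjugate to the time is `F`, evaluated at a point on the velocities `dq = q'`, `dt = t'`. -/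
def actionForm (F : PhaseSpace ι → ℝ) (z : PhaseSpace ι) (q' : ι → ℝ) (t' : ℝ) : ℝ :=
  ∑ i, z.1 i * q' i - F z * t'

/-- The change of time `dτ = v dt` identifies the trajectories of the Hamiltonian `F` (with time
`t`) on the surface `F = c` with the trajectories of the Hamiltonian `G` (with time `τ`) on the
surface `G = d`: a curve `γ`, on any open time interval `U`, is one of the former if and only if
the same curve in the new parameter is one of the latter. -/
def TimeChangeMaps (v F G : PhaseSpace ι → ℝ) (c d : ℝ) : Prop :=
  ∀ (U : Set ℝ) (γ γ' : ℝ → PhaseSpace ι) (τ : ℝ → ℝ), IsOpen U → U.OrdConnected →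
    (∀ t ∈ U, HasDerivAt τ (v (γ t)) t) → (∀ t ∈ U, γ' (τ t) = γ t) →
    ((∀ t ∈ U, F (γ t) = c ∧ SolvesHamilton F γ t) ↔
      (∀ s ∈ τ '' U, G (γ' s) = d ∧ SolvesHamilton G γ' s))

/-- A complete involutive family on `ℝ²ⁿ`: `n` smooth functions in involution which are
functionally independent, i.e. whose differentials are linearly independent on a dense set of
points (which is open, by continuity of the differentials). -/
structure IsCompleteInvolutive (I : ι → PhaseSpace ι → ℝ) : Prop where
  smooth : ∀ i, ContDiff ℝ ∞ (I i)
  involution : ∀ i j z, poisson (I i) (I j) z = 0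
  independent : Dense {z : PhaseSpace ι | LinearIndependent ℝ (fun i => fderiv ℝ (I i) z)}

end Hamiltonian

/-! ### Invariant polynomials -/

section Lie

variable {𝔤 : Type*} [LieRing 𝔤] [LieAlgebra ℝ 𝔤]

/-- `φ` is a polynomial function on `𝔤` which is invariant under the adjoint action. -/
structure IsInvariantPolynomial (φ : 𝔤 → ℝ) : Prop where
  polynomial : φ ∈ Algebra.adjoin ℝ (Set.range fun f : Module.Dual ℝ 𝔤 => (f : 𝔤 → ℝ))
  invariant : ∀ x y : 𝔤, HasDerivAt (fun s : ℝ => φ (x + s • ⁅y, x⁆)) 0 0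

end Lie

/-! ### Generalised Toda lattices -/

/-- The choices that go into the generalised Toda lattice of a simple Lie algebra `𝔤` with
splitting Cartan subalgebra `𝔞`. -/
structure TodaLattice {𝔤 : Type*} [LieRing 𝔤] [LieAlgebra ℝ 𝔤] [FiniteDimensional ℝ 𝔤]
    [LieAlgebra.IsSimple ℝ 𝔤] (𝔞 : LieSubalgebra ℝ 𝔤) [𝔞.IsCartanSubalgebra]
    [LieModule.IsTriangularizable ℝ 𝔞 𝔤] (ι : Type*) [Fintype ι] [DecidableEq ι] where
  /-- The system `P` of simple roots. -/
  simple : (LieAlgebra.IsKilling.rootSystem 𝔞).Base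
  /-- A basis `hᵢ` of the Cartan subalgebra. -/
  h : Module.Basis ι ℝ 𝔞
  /-- The root vectors `e_α`. -/
  e : simple.support → 𝔤
  /-- The root vectors `e_{-α}`. -/
  f : simple.support → 𝔤
  e_mem : ∀ α, e α ∈ LieAlgebra.rootSpace 𝔞 (α.1.1 : 𝔞 → ℝ)
  f_mem : ∀ α, f α ∈ LieAlgebra.rootSpace 𝔞 (-(α.1.1 : 𝔞 → ℝ))
  killing_e_f : ∀ α, killingForm ℝ 𝔤 (e α) (f α) = 1
  /-- The coupling constants `a_α`. -/
  a : simple.support → ℝ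

namespace TodaLattice

variable {𝔤 : Type*} [LieRing 𝔤] [LieAlgebra ℝ 𝔤] [FiniteDimensional ℝ 𝔤]
  [LieAlgebra.IsSimple ℝ 𝔤] {𝔞 : LieSubalgebra ℝ 𝔤} [𝔞.IsCartanSubalgebra]
  [LieModule.IsTriangularizable ℝ 𝔞 𝔤] {ι : Type*} [Fintype ι] [DecidableEq ι]

/-- The basis `h'ᵢ` of `𝔞` dual to `hᵢ` for the Killing form of `𝔤` (restricted to `𝔞`). -/
def dualH (T : TodaLattice 𝔞 ι) : Module.Basis ι ℝ 𝔞 :=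
  LinearMap.BilinForm.dualBasis (LieModule.traceForm ℝ 𝔞 𝔤)
    (LieAlgebra.IsKilling.traceForm_cartan_nondegenerate ℝ 𝔤 𝔞) T.h

theorem killing_h_dualH (T : TodaLattice 𝔞 ι) (i j : ι) :
    killingForm ℝ 𝔤 (T.h i) (T.dualH j) = if i = j then 1 else 0 := by
  have := LinearMap.BilinForm.apply_dualBasis_right
    (LieAlgebra.IsKilling.traceForm_cartan_nondegenerate ℝ 𝔤 𝔞)
    ⟨fun x y => LieModule.traceForm_comm ℝ 𝔞 𝔤 x y⟩ T.h i j
  exact this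

/-- The element `p = ∑ pᵢ hᵢ` of `𝔞`, so that `pᵢ = K(p, h'ᵢ)`. -/
def p (T : TodaLattice 𝔞 ι) (z : PhaseSpace ι) : 𝔞 := ∑ i, z.1 i • T.h i

/-- The element `q = ∑ qᵢ h'ᵢ` of `𝔞`, so that `qᵢ = K(q, hᵢ)`. -/
def q (T : TodaLattice 𝔞 ι) (z : PhaseSpace ι) : 𝔞 := ∑ i, z.2 i • T.dualH i

/-- The function `exp (α(q))` of a simple root `α`. -/
def expRoot (T : TodaLattice 𝔞 ι) (α : T.simple.support) (z : PhaseSpace ι) : ℝ :=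
  Real.exp (α.1.1 (T.q z))

/-- The Toda Hamiltonian `½ K(p, p) + ∑ a_α exp (α(q))`. -/
def hamiltonian (T : TodaLattice 𝔞 ι) (z : PhaseSpace ι) : ℝ :=
  (1 / 2) * killingForm ℝ 𝔤 (T.p z) (T.p z) + ∑ α, T.a α * T.expRoot α z

/-- The Lax matrix `L = p + ∑ a_α exp (α(q)) e_{-α} + ∑ e_α`. -/
def lax (T : TodaLattice 𝔞 ι) (z : PhaseSpace ι) : 𝔤 :=
  (T.p z : 𝔤) + ∑ α, (T.a α * T.expRoot α z) • T.f α + ∑ α, T.e α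

/-- The second Lax matrix `L₋ = -∑ a_α exp (α(q)) e_{-α}`. -/
def laxMinus (T : TodaLattice 𝔞 ι) (z : PhaseSpace ι) : 𝔤 :=
  -∑ α, (T.a α * T.expRoot α z) • T.f α

open Classical in
/-- The same Toda lattice with the coupling constant `a_β` replaced by `c`. -/
def withCoupling (T : TodaLattice 𝔞 ι) (β : T.simple.support) (c : ℝ) : TodaLattice 𝔞 ι :=
  { T with a := Function.update T.a β c }

/-- The new Hamiltonian `H̃ = exp (-β(q)) (H + b)`. -/
def newHamiltonian (T : TodaLattice 𝔞 ι) (β : T.simple.support) (b : ℝ) (z : PhaseSpace ι) : ℝ :=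
  (T.expRoot β z)⁻¹ * (T.hamiltonian z + b)

/-- The new Lax matrix `L̃ = L - H̃ e_β / a_β`. -/
def newLax (T : TodaLattice 𝔞 ι) (β : T.simple.support) (b : ℝ) (z : PhaseSpace ι) : 𝔤 :=
  T.lax z - (T.newHamiltonian β b z / T.a β) • T.e β

/-- The new second Lax matrix `L̃₋ = exp (-β(q)) L₋`. -/
def newLaxMinus (T : TodaLattice 𝔞 ι) (β : T.simple.support) (z : PhaseSpace ι) : 𝔤 :=
  (T.expRoot β z)⁻¹ • T.laxMinus z

end TodaLattice

end

noncomputable section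

set_option linter.unusedSectionVars false

/-! ### Changes of time -/

/-! The statements on time rest on one identity. If `H_E` is the Toda Hamiltonian with `a_β`
replaced by `a_β - E`, then `H_E = -b + e^{β(q)} (H̃ - E)`. On the common level `H_E = -b`, `H̃ = E`
the differentials are proportional with factor `e^{β(q)}`, hence so are the Hamiltonian vector
fields (`timeChangeMaps_of_eq_add_mul`).

The Lax equation is the Toda one divided by `e^{β(q)}`. Differentiating that factor adds the term
`H̃ t_β`, with `t_β` the Killing dual of `β`. The shift of `L` by a multiple of `e_β` adds the same
term to the commutator, because `[e_β, e_{-β}] = t_β`, and its own derivative drops out since `{H̃,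
H̃} = 0`. Gradients of invariants annihilate commutators with the base point, so invariants of `L̃`
are integrals.

Involution is an Adler-Kostant-Symes argument (`sum_smul_gradient_eq_zero`), valid for arbitrary
coefficients of the `e_α`, in particular for the shifted one. That this coefficient varies only adds
multiples of `{H̃, φ ∘ L̃}` and `{H̃, ψ ∘ L̃}`, which vanish.

For independence, analyticity reduces the claim to a nonzero Jacobian at one point
(`dense_linearIndependent_fderiv`). The integrals used are `tr F(ad L̃)`, whose derivative is `tr
(F'(ad L̃) ad L̃')`. Where `e^{α(q)} = δ²` for all `α ≠ β`, the Lax matrix may be replaced, for the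
purpose of invariants, by one that tends to `x + S` as `δ → 0`, with `S` in the `sl₂` of `β` and `x`
generic in the kernel of `β`. For `x` large `ad S` has imaginary spectrum, so the projections onto
the eigenspaces of `ad x` are polynomials in `ad (x + S)` (`exists_polynomial_projection`). The
projection for the eigenvalue `α(x)` sees the coweight of `α` and no other, so suitable `F` make the
limiting Jacobian diagonal and invertible (`exists_separating_polynomial`, `exists_independent`). -/

theorem SolvesHamilton.of_comp_eventuallyEq {ι : Type*} [Fintype ι] [DecidableEq ι]
    {F G : PhaseSpace ι → ℝ} {γ γ' : ℝ → PhaseSpace ι} {σ : ℝ → ℝ} {s r : ℝ}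
    (hσ : HasDerivAt σ r s) (h : SolvesHamilton F γ (σ s))
    (hγ : γ' =ᶠ[nhds s] γ ∘ σ)
    (hp : ∀ i, partialP G i (γ' s) = partialP F i (γ (σ s)) * r)
    (hq : ∀ i, partialQ G i (γ' s) = partialQ F i (γ (σ s)) * r) :
    SolvesHamilton G γ' s := by
  intro i
  obtain ⟨h1, h2⟩ := h i
  constructor
  · rw [hp]
    exact (h1.comp s hσ).congr_of_eventuallyEq
      (hγ.mono fun t ht => by simp [ht])
  · rw [hq, ← neg_mul]
    exact (h2.comp s hσ).congr_of_eventuallyEq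
      (hγ.mono fun t ht => by simp [ht])

theorem SolvesHamilton.continuousAt {ι : Type*} [Fintype ι] [DecidableEq ι]
    {F : PhaseSpace ι → ℝ} {γ : ℝ → PhaseSpace ι} {t : ℝ} (h : SolvesHamilton F γ t) :
    ContinuousAt γ t :=
  (continuousAt_pi.2 fun i => (h i).2.continuousAt).prodMk
    (continuousAt_pi.2 fun i => (h i).1.continuousAt)

/-- By the product rule `dF = v dG + (G - d) dv`, and the second term vanishes on the level `G = d`.
Hamilton's equations for `F` are therefore those for `G` run at speed `v`. -/
theorem timeChangeMaps_of_eq_add_mul {ι : Type*} [Fintype ι] [DecidableEq ι]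
    {v F G : PhaseSpace ι → ℝ} {c d : ℝ} (hv : Differentiable ℝ v) (hpos : ∀ z, 0 < v z)
    (hG : Differentiable ℝ G) (hF : ∀ z, F z = c + v z * (G z - d)) :
    TimeChangeMaps v F G c d := by
  intro U γ γ' τ hU _ hτ hγ
  have level : ∀ z, F z = c ↔ G z = d := fun z => by
    rw [hF]
    constructor
    · intro h
      have : v z * (G z - d) = 0 := by linarith
      rcases mul_eq_zero.1 this with h | h
      · exact absurd h (hpos z).ne'
      · linarith
    · intro h; simp [h]
  have hd : ∀ z, G z = d → fderiv ℝ F z = v z • fderiv ℝ G z := by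
    intro z hz
    have : F = fun z => c + v z * (G z - d) := funext hF
    have h1 : HasFDerivAt (fun z => c + v z * (G z - d))
        (v z • fderiv ℝ G z + (G z - d) • fderiv ℝ v z) z :=
      (((hv z).hasFDerivAt.mul ((hG z).hasFDerivAt.sub_const d))).const_add c
    rw [this, h1.fderiv, hz]
    simp
  have hP : ∀ z i, G z = d → partialP F i z = partialP G i z * v z := by
    intro z i hz
    simp [partialP, hd z hz, mul_comm]
  have hQ : ∀ z i, G z = d → partialQ F i z = partialQ G i z * v z := by
    intro z i hz
    simp [partialQ, hd z hz, mul_comm]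
  constructor
  · rintro h s ⟨t, ht, rfl⟩
    rw [hγ t ht]
    have hGd : G (γ t) = d := (level _).1 (h t ht).1
    refine ⟨hGd, ?_⟩
    -- Passing to the new time requires a local inverse of `τ`, hence strict differentiability. It
    -- holds because `τ' = v ∘ γ` is continuous at `t`: a solution of Hamilton's equations is
    -- continuous.
    have hstrict : HasStrictDerivAt τ (v (γ t)) t := by
      refine hasStrictDerivAt_of_hasDerivAt_of_continuousAt (f' := fun t => v (γ t)) ?_ ?_
      · filter_upwards [hU.mem_nhds ht] with x hx using hτ x hx
      · exact (hv (γ t)).continuousAt.comp (h t ht).2.continuousAt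
    have hne : v (γ t) ≠ 0 := (hpos _).ne'
    have hinv := hstrict.to_localInverse hne
    set σ := hstrict.localInverse τ (v (γ t)) t hne with hσ
    have hσt : σ (τ t) = t :=
      (hstrict.hasStrictFDerivAt_equiv hne).localInverse_apply_image
    have hright : ∀ᶠ y in nhds (τ t), τ (σ y) = y :=
      (hstrict.hasStrictFDerivAt_equiv hne).eventually_right_inverse
    have hmem : ∀ᶠ y in nhds (τ t), σ y ∈ U := by
      refine hinv.hasDerivAt.continuousAt.eventually_mem ?_
      rw [hσt]; exact hU.mem_nhds ht
    refine SolvesHamilton.of_comp_eventuallyEq (F := F) (γ := γ) (σ := σ) hinv.hasDerivAt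
      (by rw [hσt]; exact (h t ht).2) ?_ ?_ ?_
    · filter_upwards [hright, hmem] with y h1 h2
      rw [Function.comp_apply, ← hγ _ h2, h1]
    · intro i
      rw [hγ t ht, hσt, hP _ i hGd, mul_assoc, mul_inv_cancel₀ hne, mul_one]
    · intro i
      rw [hγ t ht, hσt, hQ _ i hGd, mul_assoc, mul_inv_cancel₀ hne, mul_one]
  · intro h t ht
    obtain ⟨h1, h2⟩ := h (τ t) ⟨t, ht, rfl⟩
    rw [hγ t ht] at h1
    refine ⟨(level _).2 h1, ?_⟩
    refine SolvesHamilton.of_comp_eventuallyEq (F := G) (γ := γ') (σ := τ) (hτ t ht) h2 ?_ ?_ ?_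
    · filter_upwards [hU.mem_nhds ht] with x hx using (hγ x hx).symm
    · intro i; rw [hγ t ht, hP _ i h1]
    · intro i; rw [hγ t ht, hQ _ i h1]

/-! ### Generic independence of analytic functions -/

/-- The Jacobian determinant along the fixed directions `v` is analytic on a connected space. If it
vanished near some point it would vanish identically, contrary to its value at `z₀`. -/
theorem dense_linearIndependent_fderiv {ι E : Type*} [Fintype ι] [DecidableEq ι]
    [NormedAddCommGroup E] [NormedSpace ℝ E] [CompleteSpace E] {I : ι → E → ℝ}
    (hI : ∀ i, AnalyticOnNhd ℝ (I i) Set.univ) (z₀ : E) (v : ι → E)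
    (h : (Matrix.of fun i j => fderiv ℝ (I i) z₀ (v j)).det ≠ 0) :
    Dense {z : E | LinearIndependent ℝ fun i => fderiv ℝ (I i) z} := by
  set D : E → ℝ := fun z => (Matrix.of fun i j => fderiv ℝ (I i) z (v j)).det with hD
  have hDan : AnalyticOnNhd ℝ D Set.univ := by
    have : D = fun z => ∑ σ : Equiv.Perm ι,
        ((Equiv.Perm.sign σ : ℤ) : ℝ) * ∏ i, fderiv ℝ (I (σ i)) z (v i) := by
      ext z; simp [hD, Matrix.det_apply']
    rw [this]
    intro z _
    refine Finset.analyticAt_fun_sum _ fun σ _ => analyticAt_const.mul ?_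
    refine Finset.analyticAt_fun_prod _ fun i _ => ?_
    exact ((ContinuousLinearMap.apply ℝ ℝ (v i)).analyticAt _).comp
      ((hI (σ i)).fderiv z (Set.mem_univ z))
  have hsub : {z | D z ≠ 0} ⊆ {z : E | LinearIndependent ℝ fun i => fderiv ℝ (I i) z} := by
    intro z hz
    rw [Set.mem_ofPred_eq, Fintype.linearIndependent_iff]
    intro g hg
    have h0 : Matrix.vecMul g (Matrix.of fun i j => fderiv ℝ (I i) z (v j)) = 0 := by
      ext j
      have := congrArg (fun L : E →L[ℝ] ℝ => L (v j)) hg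
      simpa [Matrix.vecMul, dotProduct] using this
    exact congrFun (Matrix.eq_zero_of_vecMul_eq_zero hz h0)
  refine Dense.mono hsub fun z => ?_
  by_contra hz
  rw [mem_closure_iff_frequently] at hz
  have hev : D =ᶠ[nhds z] 0 := by
    refine (Filter.not_frequently.1 hz).mono fun x hx => ?_
    simpa using hx
  have := hDan.eqOn_of_preconnected_of_eventuallyEq (g := 0)
    (fun x _ => analyticAt_const) isPreconnected_univ (Set.mem_univ z) hev (Set.mem_univ z₀)
  exact h this

/-! ### Traces of polynomials in a matrix -/

section Trace

open Polynomial

variable {n : Type*} [Fintype n] [DecidableEq n]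

theorem hasDerivAt_trace_pow_mul {C : ℝ → Matrix n n ℝ} {C' : Matrix n n ℝ} {s : ℝ}
    (hC : ∀ i j, HasDerivAt (fun t => C t i j) (C' i j) s) (k : ℕ) (B : Matrix n n ℝ) :
    HasDerivAt (fun t => (C t ^ k * B).trace)
      (∑ l ∈ Finset.range k, (C s ^ l * C' * C s ^ (k - 1 - l) * B).trace) s := by
  have hpow : ∀ k : ℕ, ∀ i j, HasDerivAt (fun t => (C t ^ k) i j)
      ((∑ l ∈ Finset.range k, C s ^ l * C' * C s ^ (k - 1 - l)) i j) s := by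
    intro k
    induction k with
    | zero => intro i j; simpa using hasDerivAt_const s _
    | succ k ih =>
      intro i j
      have h := HasDerivAt.fun_sum (u := Finset.univ)
        fun (m : n) _ => (ih i m).mul (hC m j)
      have e : (fun t => (C t ^ (k + 1)) i j) =
          fun t => ∑ m, (C t ^ k) i m * C t m j := by
        ext t; rw [pow_succ, Matrix.mul_apply]
      rw [e]
      refine h.congr_deriv ?_
      rw [Finset.sum_add_distrib, ← Matrix.mul_apply, ← Matrix.mul_apply, ← Matrix.add_apply,
        Finset.sum_range_succ, Finset.sum_mul]
      have e2 : (∑ l ∈ Finset.range k, C s ^ l * C' * C s ^ (k - 1 - l) * C s) =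
          ∑ l ∈ Finset.range k, C s ^ l * C' * C s ^ (k + 1 - 1 - l) := by
        refine Finset.sum_congr rfl fun l hl => ?_
        have hl := Finset.mem_range.1 hl
        have : k + 1 - 1 - l = (k - 1 - l) + 1 := by omega
        rw [this, pow_succ, mul_assoc]
      rw [e2]
      simp
  have h := HasDerivAt.fun_sum (u := Finset.univ) fun (i : n) _ =>
    HasDerivAt.fun_sum (u := Finset.univ) fun (m : n) _ => (hpow k i m).mul_const (B m i)
  refine (h.congr_deriv ?_).congr_of_eventuallyEq (.of_forall fun t => ?_)
  · rw [← Matrix.trace_sum, ← Finset.sum_mul]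
    simp only [Matrix.trace, Matrix.mul_apply (N := B), Matrix.diag_apply]
  · simp [Matrix.trace, Matrix.mul_apply]

/-- Although `C` and `C'` need not commute, cyclicity of the trace makes the `k` terms of the
derivative of a `k`-th power equal. -/
theorem hasDerivAt_trace_aeval {C : ℝ → Matrix n n ℝ} {C' : Matrix n n ℝ} {s : ℝ}
    (hC : ∀ i j, HasDerivAt (fun t => C t i j) (C' i j) s) (F : ℝ[X]) :
    HasDerivAt (fun t => (aeval (C t) F).trace) ((aeval (C s) (derivative F) * C').trace) s := by
  induction F using Polynomial.induction_on' with
  | add p q hp hq => simpa [add_mul] using hp.fun_add hq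
  | monomial k a =>
    have h := (hasDerivAt_trace_pow_mul hC k 1).const_mul a
    refine (h.congr_deriv ?_).congr_of_eventuallyEq (.of_forall fun t => ?_)
    · have : ∀ l ∈ Finset.range k, (C s ^ l * C' * C s ^ (k - 1 - l) * 1).trace =
          (C s ^ (k - 1) * C').trace := by
        intro l hl
        have hl := Finset.mem_range.1 hl
        rw [mul_one, Matrix.trace_mul_comm, ← mul_assoc, ← pow_add]
        congr 3; omega
      rw [Finset.sum_congr rfl this]
      simp [derivative_monomial, aeval_monomial, ← Algebra.smul_def, ← nsmul_eq_mul]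
    · simp [aeval_monomial, ← Algebra.smul_def]

end Trace

/-! ### Root space decompositions -/

section RootSpaces

open LieAlgebra LieAlgebra.IsKilling LieModule

variable {𝔤 : Type*} [LieRing 𝔤] [LieAlgebra ℝ 𝔤] [FiniteDimensional ℝ 𝔤]
  [LieAlgebra.IsSimple ℝ 𝔤] {𝔞 : LieSubalgebra ℝ 𝔤} [𝔞.IsCartanSubalgebra]
  [LieModule.IsTriangularizable ℝ 𝔞 𝔤]

theorem rootSpace_induction (𝔞 : LieSubalgebra ℝ 𝔤) [𝔞.IsCartanSubalgebra]
    [LieModule.IsTriangularizable ℝ 𝔞 𝔤] {motive : 𝔤 → Prop}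
    (mem : ∀ (γ : Weight ℝ 𝔞 𝔤) (x : 𝔤), x ∈ rootSpace 𝔞 γ → motive x)
    (zero : motive 0) (add : ∀ x y, motive x → motive y → motive (x + y)) (x : 𝔤) :
    motive x := by
  have h : x ∈ ⨆ γ : Weight ℝ 𝔞 𝔤, (rootSpace 𝔞 γ).toSubmodule := by
    rw [LieSubmodule.iSup_toSubmodule_eq_top.mpr (iSup_genWeightSpace_eq_top' ℝ 𝔞 𝔤)]
    trivial
  exact Submodule.iSup_induction _ (motive := motive) h mem zero add

/-- The root spaces form a direct sum, so scalars may be prescribed on them freely. With scalars `0`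
and `1` this produces the projection onto the part of negative height. -/
theorem exists_diagonal (𝔞 : LieSubalgebra ℝ 𝔤) [𝔞.IsCartanSubalgebra]
    [LieModule.IsTriangularizable ℝ 𝔞 𝔤] (c : Weight ℝ 𝔞 𝔤 → ℝ) :
    ∃ D : 𝔤 →ₗ[ℝ] 𝔤, ∀ (γ : Weight ℝ 𝔞 𝔤), ∀ x ∈ rootSpace 𝔞 γ, D x = c γ • x := by
  classical
  have hds : DirectSum.IsInternal fun γ : Weight ℝ 𝔞 𝔤 => (rootSpace 𝔞 γ).toSubmodule :=
    DirectSum.isInternal_submodule_of_iSupIndep_of_iSup_eq_top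
      (LieSubmodule.iSupIndep_toSubmodule.mpr <| iSupIndep_genWeightSpace' ℝ 𝔞 𝔤)
      (LieSubmodule.iSup_toSubmodule_eq_top.mpr <| iSup_genWeightSpace_eq_top' ℝ 𝔞 𝔤)
  let e := LinearEquiv.ofBijective (DirectSum.coeLinearMap _) hds
  refine ⟨DirectSum.toModule ℝ _ 𝔤 (fun γ => c γ • (rootSpace 𝔞 γ).toSubmodule.subtype) ∘ₗ
    e.symm.toLinearMap, fun γ x hx => ?_⟩
  have : e.symm x = DirectSum.lof ℝ _ (fun γ : Weight ℝ 𝔞 𝔤 => (rootSpace 𝔞 γ).toSubmodule) γ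
      ⟨x, hx⟩ := by
    rw [LinearEquiv.symm_apply_eq]
    exact (DirectSum.coeLinearMap_lof (fun γ : Weight ℝ 𝔞 𝔤 => (rootSpace 𝔞 γ).toSubmodule) γ
      ⟨x, hx⟩).symm
  simp [this]

theorem killingForm_lie_left (x y z : 𝔤) :
    killingForm ℝ 𝔤 ⁅x, y⁆ z = -killingForm ℝ 𝔤 y ⁅x, z⁆ := by
  have := LieModule.traceForm_apply_lie_apply ℝ 𝔤 𝔤 y x z
  rw [← lie_skew x y]
  simp only [map_neg, LinearMap.neg_apply, killingForm, this]

theorem killingForm_comm (x y : 𝔤) : killingForm ℝ 𝔤 x y = killingForm ℝ 𝔤 y x :=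
  LieModule.traceForm_comm ℝ 𝔤 𝔤 x y

theorem lie_of_mem_rootSpace {χ : 𝔞 → ℝ} {x : 𝔤} (hx : x ∈ rootSpace 𝔞 χ) (h : 𝔞) :
    ⁅(h : 𝔤), x⁆ = χ h • x :=
  lie_eq_smul_of_mem_rootSpace hx h

theorem mem_of_mem_rootSpace_isZero {γ : Weight ℝ 𝔞 𝔤} (hγ : γ.IsZero) {x : 𝔤}
    (hx : x ∈ rootSpace 𝔞 γ) : x ∈ 𝔞 := by
  have h : (γ : 𝔞 → ℝ) = 0 := hγ
  rw [h, rootSpace_zero_eq] at hx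
  exact hx

theorem coe_mem_rootSpace_zero (x : 𝔞) : (x : 𝔤) ∈ rootSpace 𝔞 (0 : 𝔞 → ℝ) := by
  rw [rootSpace_zero_eq]; exact x.2

theorem killingForm_cartanEquivDual_symm (x : 𝔞) (χ : Module.Dual ℝ 𝔞) :
    killingForm ℝ 𝔤 ((cartanEquivDual 𝔞).symm χ : 𝔤) (x : 𝔤) = χ x := by
  have : cartanEquivDual 𝔞 ((cartanEquivDual 𝔞).symm χ) x = χ x := by
    rw [LinearEquiv.apply_symm_apply]
  exact this

/-- On a split Cartan subalgebra the Killing form is the sum of the squares of the real-valued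
roots. -/
theorem killingForm_self_pos {x : 𝔞} (γ : Weight ℝ 𝔞 𝔤) (hx : γ x ≠ 0) :
    0 < killingForm ℝ 𝔤 (x : 𝔤) (x : 𝔤) := by
  have h : killingForm ℝ 𝔤 (x : 𝔤) (x : 𝔤) = ∑ α ∈ 𝔞.root, α x * α x := by
    have := congrArg (fun B => B x x) (restrict_killingForm_eq_sum (K := ℝ) (L := 𝔤) (H := 𝔞))
    simp only [LinearMap.sum_apply, LinearMap.smulRight_apply, LinearMap.smul_apply,
      smul_eq_mul] at this
    exact this
  rw [h]
  have hγ : γ.IsNonZero := fun h => hx (by rw [h]; rfl)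
  exact Finset.sum_pos' (fun α _ => mul_self_nonneg _)
    ⟨γ, by simpa using hγ, mul_self_pos.2 hx⟩

/-! ### Fundamental coweights -/

/-- The basis of the Cartan subalgebra dual to the simple roots. -/
def coweight (P : (rootSystem 𝔞).Base) (α : P.support) : 𝔞 :=
  (Module.evalEquiv ℝ 𝔞).symm (P.toWeightBasis.coord α)

theorem apply_coweight (P : (rootSystem 𝔞).Base) (α : P.support) (χ : Module.Dual ℝ 𝔞) :
    χ (coweight P α) = P.toWeightBasis.coord α χ := by
  rw [coweight, ← Module.Dual.eval_apply (R := ℝ), ← Module.evalEquiv_toLinearMap]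
  simp

theorem simple_apply_coweight_self (P : (rootSystem 𝔞).Base) (α : P.support) :
    α.1.1 (coweight P α) = 1 := by
  have h := apply_coweight P α (P.toWeightBasis α)
  rw [Module.Basis.coord_apply, Module.Basis.repr_self, Finsupp.single_eq_same] at h
  rwa [RootPairing.Base.toWeightBasis_apply] at h

theorem simple_apply_coweight_of_ne (P : (rootSystem 𝔞).Base) {α α' : P.support} (hne : α ≠ α') :
    α.1.1 (coweight P α') = 0 := by
  have h := apply_coweight P α' (P.toWeightBasis α)
  rw [Module.Basis.coord_apply, Module.Basis.repr_self, Finsupp.single_eq_of_ne hne.symm] at h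
  rwa [RootPairing.Base.toWeightBasis_apply] at h

theorem simple_apply_sum_coweight (P : (rootSystem 𝔞).Base) (α : P.support) (s : Finset P.support)
    (hα : α ∈ s) : α.1.1 (∑ α' ∈ s, coweight P α') = 1 := by
  rw [← Weight.toLinear_apply, map_sum, Finset.sum_eq_single_of_mem α hα]
  · exact simple_apply_coweight_self P α
  · exact fun α' _ h => simple_apply_coweight_of_ne P h.symm

/-- The sum of the coweights measures height, and a root is a nonzero combination of simple roots
with integer coefficients of one sign. The gap between `-1` and `1` is what separates the graded
pieces later. -/
theorem weight_apply_sum_coweight (P : (rootSystem 𝔞).Base) (γ : Weight ℝ 𝔞 𝔤) :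
    γ.IsZero ∨ 1 ≤ γ (∑ α, coweight P α) ∨ γ (∑ α, coweight P α) ≤ -1 := by
  classical
  by_cases hγ : γ.IsZero
  · exact Or.inl hγ
  right
  let r : 𝔞.root := ⟨γ, by simpa using hγ⟩
  obtain ⟨f, -, hf⟩ := P.exists_root_eq_sum_nat_or_neg r
  have hx : ∀ i ∈ P.support, (rootSystem 𝔞).root i (∑ α, coweight P α) = 1 := by
    intro i hi
    exact simple_apply_sum_coweight P ⟨i, hi⟩ _ (Finset.mem_univ _)
  have hsum : (∑ j ∈ P.support, f j • (rootSystem 𝔞).root j) (∑ α, coweight P α) =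
      ((∑ j ∈ P.support, f j : ℕ) : ℝ) := by
    rw [LinearMap.sum_apply, Nat.cast_sum]
    exact Finset.sum_congr rfl fun j hj => by rw [LinearMap.smul_apply, hx j hj]; simp
  have hγr : γ (∑ α, coweight P α) = (rootSystem 𝔞).root r (∑ α, coweight P α) := rfl
  have hpos : 1 ≤ ∑ j ∈ P.support, f j := by
    rw [Nat.one_le_iff_ne_zero]
    intro h0
    have h0' : ∀ j ∈ P.support, f j = 0 := by simpa using h0
    have : ∑ j ∈ P.support, f j • (rootSystem 𝔞).root j = 0 :=
      Finset.sum_eq_zero fun j hj => by rw [h0' j hj, zero_smul]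
    rw [this] at hf
    exact (rootSystem 𝔞).ne_zero r (by simp at hf)
  have hpos' : (1 : ℝ) ≤ ((∑ j ∈ P.support, f j : ℕ) : ℝ) := by exact_mod_cast hpos
  rcases hf with hf | hf
  · left; rw [hγr, hf, hsum]; exact hpos'
  · right; rw [hγr, hf, LinearMap.neg_apply, hsum]; linarith

end RootSpaces

/-! ### Commutation relations of the chosen root vectors, and the height grading. -/

namespace TodaLattice

open LieAlgebra LieAlgebra.IsKilling LieModule

variable {𝔤 : Type*} [LieRing 𝔤] [LieAlgebra ℝ 𝔤] [FiniteDimensional ℝ 𝔤]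
  [LieAlgebra.IsSimple ℝ 𝔤] {𝔞 : LieSubalgebra ℝ 𝔤} [𝔞.IsCartanSubalgebra]
  [LieModule.IsTriangularizable ℝ 𝔞 𝔤] {ι : Type*} [Fintype ι] [DecidableEq ι]
  (T : TodaLattice 𝔞 ι)

/-- The element of `𝔞` which represents the simple root `α` for the Killing form. -/
def t (α : T.simple.support) : 𝔞 := (cartanEquivDual 𝔞).symm α.1.1.toLinear

theorem killing_t (α : T.simple.support) (x : 𝔞) :
    killingForm ℝ 𝔤 (T.t α : 𝔤) (x : 𝔤) = α.1.1 x :=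
  killingForm_cartanEquivDual_symm x _

theorem lie_e (α : T.simple.support) (x : 𝔞) : ⁅(x : 𝔤), T.e α⁆ = α.1.1 x • T.e α :=
  lie_of_mem_rootSpace (T.e_mem α) x

theorem lie_f (α : T.simple.support) (x : 𝔞) : ⁅(x : 𝔤), T.f α⁆ = -(α.1.1 x • T.f α) := by
  rw [lie_of_mem_rootSpace (T.f_mem α) x]
  simp

theorem lie_e_f (α : T.simple.support) : ⁅T.e α, T.f α⁆ = (T.t α : 𝔤) := by
  have := lie_eq_killingForm_smul_of_mem_rootSpace_of_mem_rootSpace_neg (T.e_mem α) (T.f_mem α)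
  rw [T.killing_e_f, one_smul] at this
  exact this

/-- The difference of two distinct simple roots is neither zero nor a root, so its root space is
trivial. -/
theorem lie_e_f_of_ne {α β : T.simple.support} (h : α ≠ β) : ⁅T.e α, T.f β⁆ = 0 := by
  have hmem : ⁅T.e α, T.f β⁆ ∈ rootSpace 𝔞 ((α.1.1 : 𝔞 → ℝ) + -(β.1.1 : 𝔞 → ℝ)) :=
    lie_mem_genWeightSpace_of_mem_genWeightSpace (T.e_mem α) (T.f_mem β)
  by_contra hne
  have hbot : rootSpace 𝔞 ((α.1.1 : 𝔞 → ℝ) + -(β.1.1 : 𝔞 → ℝ)) ≠ ⊥ := by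
    intro hb
    rw [hb] at hmem
    exact hne (by simpa using hmem)
  let γ : Weight ℝ 𝔞 𝔤 := ⟨_, hbot⟩
  have hγ : γ.IsNonZero := by
    intro h0
    have h0' : (α.1.1 : 𝔞 → ℝ) + -(β.1.1 : 𝔞 → ℝ) = 0 := h0
    apply h
    apply Subtype.ext; apply Subtype.ext
    apply DFunLike.coe_injective
    rw [← sub_eq_zero, sub_eq_add_neg]
    exact h0'
  have := T.simple.sub_notMem_range_root α.2 β.2
  apply this
  refine ⟨⟨γ, by simpa using hγ⟩, ?_⟩
  ext x
  show (α.1.1 : 𝔞 → ℝ) x + -(β.1.1 : 𝔞 → ℝ) x = _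
  simp [sub_eq_add_neg]

theorem killing_coe_f (α : T.simple.support) (x : 𝔞) : killingForm ℝ 𝔤 (x : 𝔤) (T.f α) = 0 := by
  refine killingForm_apply_eq_zero_of_mem_rootSpace_of_add_ne_zero ℝ 𝔤 𝔞
    (coe_mem_rootSpace_zero x) (T.f_mem α) ?_
  rw [zero_add, neg_ne_zero]
  exact 𝔞.isNonZero_coe_root α.1

theorem e_ne_zero (α : T.simple.support) : T.e α ≠ 0 := by
  intro h
  have := T.killing_e_f α
  simp [h] at this

/-- The height element of `𝔞`, on which every simple root takes the value `1`. -/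
def heightElt : 𝔞 := ∑ α, coweight T.simple α

theorem simple_apply_heightElt (α : T.simple.support) : α.1.1 T.heightElt = 1 :=
  simple_apply_sum_coweight T.simple α _ (Finset.mem_univ _)

theorem sum_dualH_smul_h (χ : Module.Dual ℝ 𝔞) :
    ∑ i, χ (T.dualH i) • T.h i = (cartanEquivDual 𝔞).symm χ := by
  rw [LinearEquiv.eq_symm_apply]
  refine T.dualH.ext fun j => ?_
  have : ∀ i, cartanEquivDual 𝔞 (T.h i) (T.dualH j) = if i = j then 1 else 0 :=
    fun i => T.killing_h_dualH i j
  simp [this]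

/-! ### Isospectral cancellation -/

/-- Elements whose Killing gradients commute with a point of the orbit pair to zero there. -/
theorem sum_smul_gradient_eq_zero (c d : T.simple.support → ℝ) (x₀ : 𝔞) (M ξ η : 𝔤)
    (hM : M = (x₀ : 𝔤) + ∑ α, c α • T.f α + ∑ α, d α • T.e α)
    (hξ : ⁅ξ, M⁆ = 0) (hη : ⁅η, M⁆ = 0) :
    ∑ α, c α * (killingForm ℝ 𝔤 ξ (T.t α) * killingForm ℝ 𝔤 η (T.f α) -
      killingForm ℝ 𝔤 η (T.t α) * killingForm ℝ 𝔤 ξ (T.f α)) = 0 := by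
  set K := killingForm ℝ 𝔤 with hK
  set ρ : 𝔞 := T.heightElt with hρ
  -- `D` projects onto the negative heights, and `x - D x` is the component of `x` in the opposite
  -- Borel subalgebra, of heights at least `0`.
  obtain ⟨D, hD⟩ := exists_diagonal 𝔞 (fun γ : Weight ℝ 𝔞 𝔤 => if γ ρ ≤ -1 then (1 : ℝ) else 0)
  have orth : ∀ {x y : 𝔤} {j k : ℝ}, ⁅(ρ : 𝔤), x⁆ = j • x → ⁅(ρ : 𝔤), y⁆ = k • y → j + k ≠ 0 →
      K x y = 0 := by
    intro x y j k hx hy hjk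
    have h := killingForm_lie_left (ρ : 𝔤) x y
    rw [hx, hy] at h
    simp only [map_smul, LinearMap.smul_apply, smul_eq_mul] at h
    have : (j + k) * K x y = 0 := by rw [hK]; linarith
    exact (mul_eq_zero.1 this).resolve_left hjk
  have lieρ : ∀ {x y : 𝔤} {j k : ℝ}, ⁅(ρ : 𝔤), x⁆ = j • x → ⁅(ρ : 𝔤), y⁆ = k • y →
      ⁅(ρ : 𝔤), ⁅x, y⁆⁆ = (j + k) • ⁅x, y⁆ := by
    intro x y j k hx hy
    rw [leibniz_lie, hx, hy, smul_lie, lie_smul, add_smul]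
  have he : ∀ α, ⁅(ρ : 𝔤), T.e α⁆ = (1 : ℝ) • T.e α := fun α => by
    rw [T.lie_e, T.simple_apply_heightElt]
  have hf : ∀ α, ⁅(ρ : 𝔤), T.f α⁆ = (-1 : ℝ) • T.f α := fun α => by
    rw [T.lie_f, T.simple_apply_heightElt, neg_smul]
  have h0 : ∀ x : 𝔞, ⁅(ρ : 𝔤), (x : 𝔤)⁆ = (0 : ℝ) • (x : 𝔤) := fun x => by
    rw [lie_of_mem_rootSpace (coe_mem_rootSpace_zero x)]; rfl
  have hwt := fun γ : Weight ℝ 𝔞 𝔤 => weight_apply_sum_coweight T.simple γ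
  change ∀ γ : Weight ℝ 𝔞 𝔤, γ.IsZero ∨ 1 ≤ γ ρ ∨ γ ρ ≤ -1 at hwt
  have hzero : ∀ {γ : Weight ℝ 𝔞 𝔤}, γ.IsZero → γ ρ = 0 := fun {γ} h => by
    have : (γ : 𝔞 → ℝ) = 0 := h
    rw [this]; rfl
  -- A commutator of two elements of negative height has heights at most `-2`, while `M` has no
  -- component of height `2` or more to pair with it.
  have hneg : ∀ x y : 𝔤, K M ⁅D x, D y⁆ = 0 := by
    intro x y
    induction x using rootSpace_induction 𝔞 with
    | zero => simp
    | add x x' hx hx' => simp [hx, hx']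
    | mem γ x hx =>
      induction y using rootSpace_induction 𝔞 with
      | zero => simp
      | add y y' hy hy' => simp [hy, hy']
      | mem δ y hy =>
        rw [hD γ x hx, hD δ y hy]
        by_cases hγ : γ ρ ≤ -1
        swap; · simp [hγ]
        by_cases hδ : δ ρ ≤ -1
        swap; · simp [hδ]
        have hxy := lieρ (lie_of_mem_rootSpace hx ρ) (lie_of_mem_rootSpace hy ρ)
        simp only [hγ, hδ, if_true, one_smul, hM, map_add, map_sum, LinearMap.add_apply,
          LinearMap.sum_apply, map_smul, LinearMap.smul_apply]
        have e1 : K (x₀ : 𝔤) ⁅x, y⁆ = 0 := orth (h0 x₀) hxy (by linarith)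
        have e2 : ∀ α, K (T.f α) ⁅x, y⁆ = 0 := fun α => orth (hf α) hxy (by linarith)
        have e3 : ∀ α, K (T.e α) ⁅x, y⁆ = 0 := fun α => orth (he α) hxy (by linarith)
        simp [e1, e2, e3]
  -- For the nonnegative components the pairing with `M` is computed on root vectors. Only the
  -- `f`-part of `M` survives, and it sees only the height-one part of the commutator.
  have hpos : ∀ x y : 𝔤, K M ⁅x - D x, y - D y⁆ =
      ∑ α, c α * (K x (T.t α) * K y (T.f α) - K y (T.t α) * K x (T.f α)) := by
    intro x y
    induction x using rootSpace_induction 𝔞 with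
    | zero => simp
    | add x x' hx hx' =>
      rw [map_add, add_sub_add_comm, add_lie, map_add, hx, hx', ← Finset.sum_add_distrib]
      refine Finset.sum_congr rfl fun α _ => ?_
      simp only [map_add, LinearMap.add_apply]; ring
    | mem γ x hx =>
      induction y using rootSpace_induction 𝔞 with
      | zero => simp
      | add y y' hy hy' =>
        rw [map_add, add_sub_add_comm, lie_add, map_add, hy, hy', ← Finset.sum_add_distrib]
        refine Finset.sum_congr rfl fun α _ => ?_
        simp only [map_add, LinearMap.add_apply]; ring
      | mem δ y hy =>
        have hxρ := lie_of_mem_rootSpace hx ρ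
        have hyρ := lie_of_mem_rootSpace hy ρ
        rw [hD γ x hx, hD δ y hy]
        by_cases hγ : γ ρ ≤ -1
        · have e1 : ∀ α, K x (T.t α) = 0 := fun α => orth hxρ (h0 _) (by linarith)
          have e2 : ∀ α, K x (T.f α) = 0 := fun α => orth hxρ (hf _) (by linarith)
          simp [hγ, e1, e2]
        by_cases hδ : δ ρ ≤ -1
        · have e1 : ∀ α, K y (T.t α) = 0 := fun α => orth hyρ (h0 _) (by linarith)
          have e2 : ∀ α, K y (T.f α) = 0 := fun α => orth hyρ (hf _) (by linarith)
          simp [hδ, e1, e2]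
        have hγ0 : 0 ≤ γ ρ := by
          rcases hwt γ with h | h | h
          · rw [hzero h]
          · linarith
          · exact absurd h hγ
        have hδ0 : 0 ≤ δ ρ := by
          rcases hwt δ with h | h | h
          · rw [hzero h]
          · linarith
          · exact absurd h hδ
        simp only [hγ, hδ, if_false, zero_smul, sub_zero, hM, map_add, map_sum,
          LinearMap.add_apply, LinearMap.sum_apply, map_smul, LinearMap.smul_apply, smul_eq_mul]
        have hxy := lieρ hxρ hyρ
        have e3 : ∀ α, K (T.e α) ⁅x, y⁆ = 0 := fun α => orth (he α) hxy (by linarith)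
        -- By invariance this is a multiple of `γ(x₀) K(x, y)`. Either `γ = 0`, or the total height
        -- is positive and `K(x, y) = 0`.
        have e1 : K (x₀ : 𝔤) ⁅x, y⁆ = 0 := by
          have h := killingForm_lie_left x (x₀ : 𝔤) y
          rw [← lie_skew, lie_of_mem_rootSpace hx] at h
          simp only [map_neg, map_smul, LinearMap.neg_apply, LinearMap.smul_apply,
            neg_inj, smul_eq_mul] at h
          rw [hK, ← h]
          rcases hwt γ with hz | hz | hz
          · rw [show (γ : 𝔞 → ℝ) = 0 from hz]; simp
          · rw [show killingForm ℝ 𝔤 x y = 0 from orth hxρ hyρ (by linarith), mul_zero]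
          · exact absurd hz hγ
        have e2 : ∀ α, K (T.f α) ⁅x, y⁆ =
            K x (T.t α) * K y (T.f α) - K y (T.t α) * K x (T.f α) := by
          intro α
          have key : ∀ (u : 𝔞) (v : 𝔤), K (T.f α) ⁅(u : 𝔤), v⁆ =
              K (u : 𝔤) (T.t α) * K v (T.f α) := by
            intro u v
            have h := killingForm_lie_left (u : 𝔤) (T.f α) v
            rw [T.lie_f] at h
            simp only [map_neg, map_smul, LinearMap.neg_apply, LinearMap.smul_apply,
              neg_inj, smul_eq_mul] at h
            rw [hK, ← h, killingForm_comm (u : 𝔤), T.killing_t, killingForm_comm v]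
          rcases hwt γ with hz | hz | hz
          · have hm := mem_of_mem_rootSpace_isZero hz hx
            have : K x (T.f α) = 0 := T.killing_coe_f α ⟨x, hm⟩
            rw [this, mul_zero, sub_zero]
            exact key ⟨x, hm⟩ y
          · have hxt : K x (T.t α) = 0 := orth hxρ (h0 _) (by linarith)
            rcases hwt δ with hz' | hz' | hz'
            · have hm := mem_of_mem_rootSpace_isZero hz' hy
              have := key ⟨y, hm⟩ x
              rw [← lie_skew, map_neg, this, hxt]
              simp
            · have hyt : K y (T.t α) = 0 := orth hyρ (h0 _) (by linarith)
              rw [hxt, hyt, orth (hf α) hxy (by linarith)]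
              simp
            · exact absurd hz' hδ
          · exact absurd hz hγ
        simp [e1, e2, e3]
  rw [← hpos]
  -- Since `ξ` and `η` centralise `M`, every bracket with one of them pairs to zero with `M`. Hence
  -- the pairing of `M` with the bracket of the nonnegative components equals that with the bracket
  -- of the negative ones, which is zero.
  have a1 : ∀ y, K M ⁅ξ, y⁆ = 0 := fun y => by
    have h := killingForm_lie_left ξ M y
    rw [hξ] at h
    simpa using h.symm
  have a2 : ∀ y, K M ⁅y, η⁆ = 0 := fun y => by
    rw [← lie_skew, map_neg, neg_eq_zero]
    have h := killingForm_lie_left η M y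
    rw [hη] at h
    simpa using h.symm
  have := hneg ξ η
  simp only [sub_lie, lie_sub, map_sub, a1, a2, this]
  simp

end TodaLattice

/-! ### Polynomial functions and their gradients -/

section Gradient

variable {𝔤 : Type*} [LieRing 𝔤] [LieAlgebra ℝ 𝔤] [FiniteDimensional ℝ 𝔤]

/-- `𝔤` carries no norm, so analysis on it is done in the coordinates of a fixed basis. -/
theorem analyticOnNhd_of_mem_adjoin {φ : 𝔤 → ℝ}
    (hφ : φ ∈ Algebra.adjoin ℝ (Set.range fun f : Module.Dual ℝ 𝔤 => (f : 𝔤 → ℝ))) :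
    AnalyticOnNhd ℝ (fun c => φ ((Module.finBasis ℝ 𝔤).equivFun.symm c)) Set.univ := by
  induction hφ using Algebra.adjoin_induction with
  | mem φ hφ =>
    obtain ⟨f, rfl⟩ := hφ
    exact (LinearMap.toContinuousLinearMap
      (f ∘ₗ (Module.finBasis ℝ 𝔤).equivFun.symm.toLinearMap)).analyticOnNhd _
  | algebraMap r => exact analyticOnNhd_const
  | add φ ψ _ _ h h' => exact h.add h'
  | mul φ ψ _ _ h h' => exact h.mul h'

/-- The differential of a function on a finite-dimensional Lie algebra, computed in a basis. -/
def polyGradient (φ : 𝔤 → ℝ) (x : 𝔤) : Module.Dual ℝ 𝔤 :=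
  (fderiv ℝ (fun c => φ ((Module.finBasis ℝ 𝔤).equivFun.symm c))
    ((Module.finBasis ℝ 𝔤).equivFun x)).toLinearMap ∘ₗ (Module.finBasis ℝ 𝔤).equivFun.toLinearMap

variable {E : Type*} [NormedAddCommGroup E] [NormedSpace ℝ E] {φ : 𝔤 → ℝ}

theorem AnalyticAt.comp_polynomial
    (hφ : φ ∈ Algebra.adjoin ℝ (Set.range fun f : Module.Dual ℝ 𝔤 => (f : 𝔤 → ℝ)))
    {X : E → 𝔤} {z : E} (hX : ∀ ℓ : Module.Dual ℝ 𝔤, AnalyticAt ℝ (fun w => ℓ (X w)) z) :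
    AnalyticAt ℝ (φ ∘ X) z := by
  have h : AnalyticAt ℝ (fun w => (Module.finBasis ℝ 𝔤).equivFun (X w)) z :=
    AnalyticAt.pi fun k => hX ((Module.finBasis ℝ 𝔤).coord k)
  have := (analyticOnNhd_of_mem_adjoin hφ _ (Set.mem_univ _)).comp h
  simpa [Function.comp_def] using this

/-- The chain rule, with differentiability of the `𝔤`-valued map tested against linear forms because
`𝔤` has no topology. -/
theorem hasFDerivAt_comp_polynomial
    (hφ : φ ∈ Algebra.adjoin ℝ (Set.range fun f : Module.Dual ℝ 𝔤 => (f : 𝔤 → ℝ)))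
    [FiniteDimensional ℝ E] {X : E → 𝔤} {X' : E →ₗ[ℝ] 𝔤} {z : E}
    (hX : ∀ ℓ : Module.Dual ℝ 𝔤, HasFDerivAt (fun w => ℓ (X w))
      (LinearMap.toContinuousLinearMap (ℓ ∘ₗ X')) z) :
    HasFDerivAt (φ ∘ X) (LinearMap.toContinuousLinearMap (polyGradient φ (X z) ∘ₗ X')) z := by
  have h : HasFDerivAt (fun w => (Module.finBasis ℝ 𝔤).equivFun (X w))
      (LinearMap.toContinuousLinearMap ((Module.finBasis ℝ 𝔤).equivFun.toLinearMap ∘ₗ X')) z := by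
    rw [hasFDerivAt_pi']
    intro k
    exact hX ((Module.finBasis ℝ 𝔤).coord k)
  have h2 := ((analyticOnNhd_of_mem_adjoin hφ _
    (Set.mem_univ ((Module.finBasis ℝ 𝔤).equivFun (X z)))).differentiableAt.hasFDerivAt).comp z h
  simp only [Function.comp_def, LinearEquiv.symm_apply_apply] at h2
  exact h2

theorem IsInvariantPolynomial.gradient_lie (hφ : IsInvariantPolynomial φ) (x y : 𝔤) :
    polyGradient φ x ⁅y, x⁆ = 0 := by
  have h := hasFDerivAt_comp_polynomial hφ.polynomial (X := fun s : ℝ => x + s • ⁅y, x⁆)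
    (X' := LinearMap.toSpanSingleton ℝ 𝔤 ⁅y, x⁆) (z := 0) (fun ℓ => by
      simp only [map_add, map_smul, smul_eq_mul]
      have h1 := ((hasDerivAt_id (0 : ℝ)).mul_const (ℓ ⁅y, x⁆)).const_add (ℓ x)
      refine HasFDerivAt.congr_fderiv h1.hasFDerivAt ?_
      ext
      simp)
  have h1 := h.hasDerivAt.unique (hφ.invariant x y)
  simpa using h1

end Gradient

namespace TodaLattice

open LieAlgebra LieAlgebra.IsKilling LieModule

variable {𝔤 : Type*} [LieRing 𝔤] [LieAlgebra ℝ 𝔤] [FiniteDimensional ℝ 𝔤]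
  [LieAlgebra.IsSimple ℝ 𝔤] {𝔞 : LieSubalgebra ℝ 𝔤} [𝔞.IsCartanSubalgebra]
  [LieModule.IsTriangularizable ℝ 𝔞 𝔤] {ι : Type*} [Fintype ι] [DecidableEq ι]
  (T : TodaLattice 𝔞 ι) (β : T.simple.support) (b : ℝ)

/-! ### Differentials of the Toda functions -/

/-- The momentum `p` as a linear map. -/
def pLin : PhaseSpace ι →ₗ[ℝ] 𝔞 where
  toFun := T.p
  map_add' z w := by simp [p, add_smul, Finset.sum_add_distrib]
  map_smul' c z := by simp [p, mul_smul, Finset.smul_sum]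

/-- The position `q` as a linear map. -/
def qLin : PhaseSpace ι →ₗ[ℝ] 𝔞 where
  toFun := T.q
  map_add' z w := by simp [q, add_smul, Finset.sum_add_distrib]
  map_smul' c z := by simp [q, mul_smul, Finset.smul_sum]

/-- The linear form `α(q)` on the phase space. -/
def rootForm (α : T.simple.support) : PhaseSpace ι →ₗ[ℝ] ℝ := α.1.1.toLinear ∘ₗ T.qLin

/-- The bilinear form `K(p, p')` on the phase space. -/
def kinetic : PhaseSpace ι →ₗ[ℝ] PhaseSpace ι →ₗ[ℝ] ℝ :=
  (killingForm ℝ 𝔤).compl₁₂ (𝔞.toSubmodule.subtype ∘ₗ T.pLin) (𝔞.toSubmodule.subtype ∘ₗ T.pLin)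

theorem kinetic_apply (z w : PhaseSpace ι) :
    T.kinetic z w = killingForm ℝ 𝔤 (T.p z : 𝔤) (T.p w : 𝔤) := rfl

/-- The differential of the Toda Hamiltonian. -/
def dHamiltonian (z : PhaseSpace ι) : PhaseSpace ι →ₗ[ℝ] ℝ :=
  T.kinetic z + ∑ α, (T.a α * T.expRoot α z) • T.rootForm α

/-- The differential of the new Hamiltonian. -/
def dNewHamiltonian (z : PhaseSpace ι) : PhaseSpace ι →ₗ[ℝ] ℝ :=
  (T.expRoot β z)⁻¹ • T.dHamiltonian z - T.newHamiltonian β b z • T.rootForm β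

/-- The differential of the new Lax matrix. -/
def dNewLax (z : PhaseSpace ι) : PhaseSpace ι →ₗ[ℝ] 𝔤 :=
  𝔞.toSubmodule.subtype ∘ₗ T.pLin +
    ∑ α, (T.rootForm α).smulRight ((T.a α * T.expRoot α z) • T.f α) -
    (T.dNewHamiltonian β b z).smulRight ((T.a β)⁻¹ • T.e β)

theorem hasFDerivAt_expRoot (α : T.simple.support) (z : PhaseSpace ι) :
    HasFDerivAt (T.expRoot α) (T.expRoot α z • LinearMap.toContinuousLinearMap (T.rootForm α)) z :=
  (LinearMap.toContinuousLinearMap (T.rootForm α)).hasFDerivAt.exp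

theorem analyticAt_expRoot (α : T.simple.support) (z : PhaseSpace ι) :
    AnalyticAt ℝ (T.expRoot α) z :=
  ((LinearMap.toContinuousLinearMap (T.rootForm α)).analyticAt z).rexp

theorem expRoot_pos (α : T.simple.support) (z : PhaseSpace ι) : 0 < T.expRoot α z :=
  Real.exp_pos _

theorem kinetic_eq_sum (z : PhaseSpace ι) :
    killingForm ℝ 𝔤 (T.p z : 𝔤) (T.p z : 𝔤) =
      ∑ i, z.1 i * killingForm ℝ 𝔤 (T.h i : 𝔤) (T.p z : 𝔤) := by
  nth_rw 1 [p]
  simp [LinearMap.sum_apply]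

theorem hasFDerivAt_hamiltonian (z : PhaseSpace ι) :
    HasFDerivAt T.hamiltonian (LinearMap.toContinuousLinearMap (T.dHamiltonian z)) z := by
  have hk : HasFDerivAt (fun w => killingForm ℝ 𝔤 (T.p w : 𝔤) (T.p w : 𝔤))
      ((2 : ℝ) • LinearMap.toContinuousLinearMap (T.kinetic z)) z := by
    have h1 : ∀ i, HasFDerivAt (fun w : PhaseSpace ι => w.1 i)
        ((ContinuousLinearMap.proj i).comp (ContinuousLinearMap.fst ℝ (ι → ℝ) (ι → ℝ))) z :=
      fun i => ((ContinuousLinearMap.proj i).comp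
        (ContinuousLinearMap.fst ℝ (ι → ℝ) (ι → ℝ))).hasFDerivAt
    have h2 : ∀ i, HasFDerivAt (fun w => killingForm ℝ 𝔤 (T.h i : 𝔤) (T.p w : 𝔤))
        (LinearMap.toContinuousLinearMap
          (killingForm ℝ 𝔤 (T.h i : 𝔤) ∘ₗ 𝔞.toSubmodule.subtype ∘ₗ T.pLin)) z :=
      fun i => (LinearMap.toContinuousLinearMap
          (killingForm ℝ 𝔤 (T.h i : 𝔤) ∘ₗ 𝔞.toSubmodule.subtype ∘ₗ T.pLin)).hasFDerivAt
    have h3 := HasFDerivAt.fun_sum (u := Finset.univ) fun i _ => (h1 i).mul (h2 i)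
    simp only [kinetic_eq_sum]
    refine h3.congr_fderiv ?_
    refine ContinuousLinearMap.ext fun w => ?_
    have e1 : ∀ z w : PhaseSpace ι, ∑ i, z.1 i * killingForm ℝ 𝔤 (T.h i : 𝔤) (T.p w : 𝔤) =
        killingForm ℝ 𝔤 (T.p z : 𝔤) (T.p w : 𝔤) := by
      intro z w
      nth_rw 2 [p]
      simp [LinearMap.sum_apply]
    have e2 : ∑ i, (z.1 i * killingForm ℝ 𝔤 (T.h i : 𝔤) (T.p w : 𝔤) +
        killingForm ℝ 𝔤 (T.h i : 𝔤) (T.p z : 𝔤) * w.1 i) =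
        2 * killingForm ℝ 𝔤 (T.p z : 𝔤) (T.p w : 𝔤) := by
      rw [Finset.sum_add_distrib, e1, two_mul, killingForm_comm (T.p z : 𝔤), ← e1 w z]
      simp only [mul_comm]
    rw [_root_.sum_apply]
    exact e2
  have h := (hk.const_mul (1 / 2)).add (HasFDerivAt.fun_sum (u := Finset.univ) fun α _ =>
    (T.hasFDerivAt_expRoot α z).const_mul (T.a α))
  refine h.congr_fderiv ?_
  refine ContinuousLinearMap.ext fun w => ?_
  simp [dHamiltonian, mul_assoc]

theorem analyticAt_hamiltonian (z : PhaseSpace ι) : AnalyticAt ℝ T.hamiltonian z := by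
  unfold hamiltonian
  refine AnalyticAt.add (analyticAt_const.mul ?_)
    (Finset.analyticAt_fun_sum _ fun α _ => analyticAt_const.mul (T.analyticAt_expRoot α z))
  simp only [kinetic_eq_sum]
  refine Finset.analyticAt_fun_sum _ fun i _ => AnalyticAt.mul ?_ ?_
  · exact ((ContinuousLinearMap.proj i).comp
        (ContinuousLinearMap.fst ℝ (ι → ℝ) (ι → ℝ))).analyticAt z
  · exact (LinearMap.toContinuousLinearMap
      (killingForm ℝ 𝔤 (T.h i : 𝔤) ∘ₗ 𝔞.toSubmodule.subtype ∘ₗ T.pLin)).analyticAt z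

theorem hasFDerivAt_newHamiltonian (z : PhaseSpace ι) :
    HasFDerivAt (T.newHamiltonian β b)
      (LinearMap.toContinuousLinearMap (T.dNewHamiltonian β b z)) z := by
  have hne := (T.expRoot_pos β z).ne'
  have h1 := (hasDerivAt_inv hne).comp_hasFDerivAt z (T.hasFDerivAt_expRoot β z)
  have h := h1.mul ((T.hasFDerivAt_hamiltonian z).add_const b)
  refine h.congr_fderiv ?_
  refine ContinuousLinearMap.ext fun w => ?_
  simp [dNewHamiltonian, newHamiltonian]
  field_simp
  ring

theorem analyticAt_newHamiltonian (z : PhaseSpace ι) :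
    AnalyticAt ℝ (T.newHamiltonian β b) z :=
  ((T.analyticAt_expRoot β z).inv (T.expRoot_pos β z).ne').mul
    ((T.analyticAt_hamiltonian z).add analyticAt_const)

theorem dual_newLax (ℓ : Module.Dual ℝ 𝔤) (z : PhaseSpace ι) :
    ℓ (T.newLax β b z) = ℓ (T.p z : 𝔤) + ∑ α, T.a α * T.expRoot α z * ℓ (T.f α) +
      ∑ α, ℓ (T.e α) - T.newHamiltonian β b z / T.a β * ℓ (T.e β) := by
  simp [newLax, lax]

theorem hasFDerivAt_newLax (ℓ : Module.Dual ℝ 𝔤) (z : PhaseSpace ι) :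
    HasFDerivAt (fun w => ℓ (T.newLax β b w))
      (LinearMap.toContinuousLinearMap (ℓ ∘ₗ T.dNewLax β b z)) z := by
  simp only [dual_newLax]
  have h1 : HasFDerivAt (fun w => ℓ (T.p w : 𝔤)) _ z := (LinearMap.toContinuousLinearMap
      (ℓ ∘ₗ 𝔞.toSubmodule.subtype ∘ₗ T.pLin)).hasFDerivAt
  have h2 := HasFDerivAt.fun_sum (u := Finset.univ) fun α _ =>
    ((T.hasFDerivAt_expRoot α z).const_mul (T.a α)).mul_const (ℓ (T.f α))
  have h3 := ((T.hasFDerivAt_newHamiltonian β b z).mul_const (T.a β)⁻¹).mul_const (ℓ (T.e β))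
  have h := ((h1.add h2).add_const (∑ α, ℓ (T.e α))).sub h3
  refine h.congr_fderiv ?_
  refine ContinuousLinearMap.ext fun w => ?_
  simp [dNewLax, LinearMap.sum_apply]
  congr 1
  · congr 1
    exact Finset.sum_congr rfl fun α _ => by ring
  · ring

theorem analyticAt_newLax (ℓ : Module.Dual ℝ 𝔤) (z : PhaseSpace ι) :
    AnalyticAt ℝ (fun w => ℓ (T.newLax β b w)) z := by
  simp only [dual_newLax]
  refine AnalyticAt.sub (AnalyticAt.add (AnalyticAt.add ?_ ?_) analyticAt_const) ?_
  · exact (LinearMap.toContinuousLinearMap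
      (ℓ ∘ₗ 𝔞.toSubmodule.subtype ∘ₗ T.pLin)).analyticAt z
  · exact Finset.analyticAt_fun_sum _ fun α _ =>
      (analyticAt_const.mul (T.analyticAt_expRoot α z)).mul analyticAt_const
  · simp only [div_eq_mul_inv]
    exact ((T.analyticAt_newHamiltonian β b z).mul analyticAt_const).mul analyticAt_const

/-! ### Poisson brackets -/

theorem p_single (i : ι) : T.p (Pi.single i 1, 0) = T.h i := by
  simp [p, Pi.single_apply]

theorem p_zero (v : ι → ℝ) : T.p (0, v) = 0 := by simp [p]

theorem q_single (i : ι) : T.q (0, Pi.single i 1) = T.dualH i := by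
  simp [q, Pi.single_apply]

theorem q_zero (v : ι → ℝ) : T.q (v, 0) = 0 := by simp [q]

theorem rootForm_single (α : T.simple.support) (i : ι) :
    T.rootForm α (0, Pi.single i 1) = α.1.1 (T.dualH i) := by
  rw [← T.q_single i]; rfl

theorem rootForm_zero (α : T.simple.support) (v : ι → ℝ) : T.rootForm α (v, 0) = 0 := by
  have : T.rootForm α (v, 0) = Weight.toLinear ℝ 𝔞 𝔤 α.1.1 (T.q (v, 0)) := rfl
  rw [this, T.q_zero, map_zero]

theorem kinetic_single (z : PhaseSpace ι) (i : ι) :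
    T.kinetic z (Pi.single i 1, 0) = killingForm ℝ 𝔤 (T.p z : 𝔤) (T.h i : 𝔤) := by
  rw [kinetic_apply, T.p_single]

theorem kinetic_zero (z : PhaseSpace ι) (v : ι → ℝ) : T.kinetic z (0, v) = 0 := by
  rw [kinetic_apply, T.p_zero]; simp

theorem partialP_newHamiltonian (i : ι) (z : PhaseSpace ι) :
    partialP (T.newHamiltonian β b) i z =
      (T.expRoot β z)⁻¹ * killingForm ℝ 𝔤 (T.p z : 𝔤) (T.h i : 𝔤) := by
  rw [partialP, (T.hasFDerivAt_newHamiltonian β b z).fderiv]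
  simp [dNewHamiltonian, dHamiltonian, rootForm_zero, kinetic_single]

theorem partialQ_newHamiltonian (i : ι) (z : PhaseSpace ι) :
    partialQ (T.newHamiltonian β b) i z =
      (T.expRoot β z)⁻¹ * ∑ α, T.a α * T.expRoot α z * α.1.1 (T.dualH i) -
        T.newHamiltonian β b z * β.1.1 (T.dualH i) := by
  rw [partialQ, (T.hasFDerivAt_newHamiltonian β b z).fderiv]
  simp [dNewHamiltonian, dHamiltonian, rootForm_single, kinetic_zero]

theorem dNewLax_single_left (i : ι) (z : PhaseSpace ι) :
    T.dNewLax β b z (Pi.single i 1, 0) =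
      (T.h i : 𝔤) - (partialP (T.newHamiltonian β b) i z / T.a β) • T.e β := by
  rw [partialP, (T.hasFDerivAt_newHamiltonian β b z).fderiv]
  have : T.pLin (Pi.single i 1, 0) = T.h i := T.p_single i
  simp [dNewLax, rootForm_zero, LinearMap.sum_apply, this, smul_smul, div_eq_mul_inv]

theorem dNewLax_single_right (i : ι) (z : PhaseSpace ι) :
    T.dNewLax β b z (0, Pi.single i 1) =
      ∑ α, (T.a α * T.expRoot α z * α.1.1 (T.dualH i)) • T.f α -
        (partialQ (T.newHamiltonian β b) i z / T.a β) • T.e β := by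
  rw [partialQ, (T.hasFDerivAt_newHamiltonian β b z).fderiv]
  have : T.pLin (0, Pi.single i 1) = 0 := T.p_zero _
  simp [dNewLax, rootForm_single, LinearMap.sum_apply, this, smul_smul, div_eq_mul_inv, mul_comm]

theorem poissonVec_newLax_eq_sum (F : PhaseSpace ι → ℝ) (z : PhaseSpace ι) :
    poissonVec F (T.newLax β b) z =
      ∑ i, (partialP F i z • T.dNewLax β b z (0, Pi.single i 1) -
        partialQ F i z • T.dNewLax β b z (Pi.single i 1, 0)) := by
  have h : ∀ k v, fderiv ℝ (fun w => (Module.finBasis ℝ 𝔤).repr (T.newLax β b w) k) z v =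
      (Module.finBasis ℝ 𝔤).repr (T.dNewLax β b z v) k := fun k v => by
    have := (T.hasFDerivAt_newLax β b ((Module.finBasis ℝ 𝔤).coord k) z).fderiv
    simp only [Module.Basis.coord_apply] at this
    rw [this]; rfl
  conv_rhs => rw [← (Module.finBasis ℝ 𝔤).sum_repr (∑ i, _)]
  refine Finset.sum_congr rfl fun k _ => ?_
  rw [poisson]
  simp only [partialP, partialQ, h]
  simp

theorem poisson_comp_newLax {φ : 𝔤 → ℝ} (hφ : IsInvariantPolynomial φ) (F : PhaseSpace ι → ℝ)
    (z : PhaseSpace ι) :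
    poisson F (φ ∘ T.newLax β b) z =
      polyGradient φ (T.newLax β b z) (poissonVec F (T.newLax β b) z) := by
  rw [poissonVec_newLax_eq_sum, poisson]
  have h := hasFDerivAt_comp_polynomial hφ.polynomial (fun ℓ => T.hasFDerivAt_newLax β b ℓ z)
  simp only [partialP, partialQ, h.fderiv]
  simp

theorem sum_apply_dualH_smul_h (α : T.simple.support) :
    ∑ i, α.1.1 (T.dualH i) • (T.h i : 𝔤) = (T.t α : 𝔤) := by
  have h := T.sum_dualH_smul_h α.1.1.toLinear
  have h2 := congrArg (fun x : 𝔞 => (x : 𝔤)) h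
  simp only [AddSubmonoidClass.coe_finsetSum] at h2
  exact h2

theorem sum_killing_mul_apply (α : T.simple.support) (x : 𝔤) :
    ∑ i, killingForm ℝ 𝔤 x (T.h i : 𝔤) * α.1.1 (T.dualH i) = killingForm ℝ 𝔤 x (T.t α : 𝔤) := by
  rw [← sum_apply_dualH_smul_h, map_sum]
  simp [mul_comm]

/-- The Lax equation of the new system. -/
theorem poissonVec_newHamiltonian_newLax (hβ : T.a β ≠ 0) (z : PhaseSpace ι) :
    poissonVec (T.newHamiltonian β b) (T.newLax β b) z =
      ⁅T.newLax β b z, T.newLaxMinus β z⁆ := by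
  have hx := (T.expRoot_pos β z).ne'
  have key : ⁅T.lax z, T.laxMinus z⁆ =
      ∑ α, (T.a α * T.expRoot α z * α.1.1 (T.p z)) • T.f α -
        ∑ α, (T.a α * T.expRoot α z) • (T.t α : 𝔤) := by
    rw [lax, laxMinus]
    set S := ∑ α, (T.a α * T.expRoot α z) • T.f α with hS
    have e1 : ⁅(T.p z : 𝔤), S⁆ = -∑ α, (T.a α * T.expRoot α z * α.1.1 (T.p z)) • T.f α := by
      rw [hS, lie_sum, ← Finset.sum_neg_distrib]
      exact Finset.sum_congr rfl fun α _ => by rw [lie_smul, lie_f, smul_neg, smul_smul]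
    have e2 : ⁅∑ α, T.e α, S⁆ = ∑ α, (T.a α * T.expRoot α z) • (T.t α : 𝔤) := by
      rw [hS, lie_sum]
      refine Finset.sum_congr rfl fun α _ => ?_
      rw [lie_smul, sum_lie, Finset.sum_eq_single α, lie_e_f]
      · exact fun γ _ h => T.lie_e_f_of_ne h
      · simp
    rw [lie_neg, add_lie, add_lie, lie_self, e1, e2]
    abel
  -- Only the `β`-term of `L₋` meets `e_β`. Multiplied by `-H̃ e^{-β(q)} / a_β`, this is the
  -- correction `H̃ t_β` that the shift contributes.
  have hβM : ⁅T.e β, T.laxMinus z⁆ = -((T.a β * T.expRoot β z) • (T.t β : 𝔤)) := by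
    rw [laxMinus, lie_neg, lie_sum, Finset.sum_eq_single β, lie_smul, lie_e_f]
    · intro γ _ h; rw [lie_smul, T.lie_e_f_of_ne h.symm, smul_zero]
    · simp
  rw [newLax, newLaxMinus, sub_lie, lie_smul, lie_smul, smul_lie, key, hβM,
    poissonVec_newLax_eq_sum]
  have step : ∀ i, (partialP (T.newHamiltonian β b) i z • T.dNewLax β b z (0, Pi.single i 1) -
        partialQ (T.newHamiltonian β b) i z • T.dNewLax β b z (Pi.single i 1, 0)) =
      (T.expRoot β z)⁻¹ • ∑ α, (T.a α * T.expRoot α z) •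
        ((killingForm ℝ 𝔤 (T.p z : 𝔤) (T.h i : 𝔤) * α.1.1 (T.dualH i)) • T.f α) -
      (T.expRoot β z)⁻¹ • ∑ α, (T.a α * T.expRoot α z) • (α.1.1 (T.dualH i) • (T.h i : 𝔤)) +
      T.newHamiltonian β b z • (β.1.1 (T.dualH i) • (T.h i : 𝔤)) := by
    intro i
    rw [dNewLax_single_left, dNewLax_single_right]
    -- The derivative of the coefficient of `e_β` cancels: this is `{H̃, H̃} = 0`, term by term.
    have e : ∀ x y : ℝ, ∀ u w : 𝔤, x • (u - (y / T.a β) • T.e β) - y • (w - (x / T.a β) • T.e β) =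
        x • u - y • w := fun x y u w => by module
    rw [e, partialP_newHamiltonian, partialQ_newHamiltonian, sub_smul, mul_smul, mul_smul, mul_smul,
      Finset.sum_smul, Finset.smul_sum]
    simp only [mul_smul]
    rw [sub_sub_eq_add_sub]
    have : ∀ α, killingForm ℝ 𝔤 (T.p z : 𝔤) (T.h i : 𝔤) • T.a α • T.expRoot α z •
        α.1.1 (T.dualH i) • T.f α = T.a α • T.expRoot α z •
        killingForm ℝ 𝔤 (T.p z : 𝔤) (T.h i : 𝔤) • α.1.1 (T.dualH i) • T.f α := fun α => by module
    simp only [this]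
    abel
  rw [Finset.sum_congr rfl fun i _ => step i, Finset.sum_add_distrib, Finset.sum_sub_distrib,
    ← Finset.smul_sum, ← Finset.smul_sum, ← Finset.smul_sum, sum_apply_dualH_smul_h,
    Finset.sum_comm, Finset.sum_comm (f := fun i α => (T.a α * T.expRoot α z) •
      (α.1.1 (T.dualH i) • (T.h i : 𝔤)))]
  simp only [← Finset.smul_sum, ← Finset.sum_smul, sum_apply_dualH_smul_h, sum_killing_mul_apply]
  have hpt : ∀ α, killingForm ℝ 𝔤 (T.p z : 𝔤) (T.t α : 𝔤) = α.1.1 (T.p z) := fun α => by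
    rw [killingForm_comm, killing_t]
  simp only [hpt, smul_smul]
  rw [smul_sub, smul_neg, sub_neg_eq_add, smul_smul]
  congr 2
  field_simp

theorem poisson_newHamiltonian_comp_newLax (hβ : T.a β ≠ 0) {φ : 𝔤 → ℝ}
    (hφ : IsInvariantPolynomial φ) (z : PhaseSpace ι) :
    poisson (T.newHamiltonian β b) (φ ∘ T.newLax β b) z = 0 := by
  rw [poisson_comp_newLax T β b hφ, poissonVec_newHamiltonian_newLax T β b hβ, ← lie_skew, map_neg,
    hφ.gradient_lie, neg_zero]

theorem contDiff_comp_newLax {φ : 𝔤 → ℝ} (hφ : IsInvariantPolynomial φ) :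
    ContDiff ℝ ∞ (φ ∘ T.newLax β b) :=
  contDiff_iff_contDiffAt.2 fun z =>
    (AnalyticAt.comp_polynomial hφ.polynomial fun ℓ => T.analyticAt_newLax β b ℓ z).contDiffAt

/-- The Killing gradient of an invariant polynomial commutes with the point it is taken at. -/
theorem exists_killing_gradient {φ : 𝔤 → ℝ} (hφ : IsInvariantPolynomial φ) (x : 𝔤) :
    ∃ ξ : 𝔤, (∀ y, polyGradient φ x y = killingForm ℝ 𝔤 ξ y) ∧ ⁅ξ, x⁆ = 0 := by
  have hnd : (killingForm ℝ 𝔤).Nondegenerate := IsKilling.killingForm_nondegenerate ℝ 𝔤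
  refine ⟨((killingForm ℝ 𝔤).toDual hnd).symm (polyGradient φ x), fun y => ?_, ?_⟩
  · rw [LinearMap.BilinForm.apply_toDual_symm_apply]
  · set ξ := ((killingForm ℝ 𝔤).toDual hnd).symm (polyGradient φ x) with hξ
    have h : ∀ y, killingForm ℝ 𝔤 ξ ⁅y, x⁆ = 0 := fun y => by
      rw [hξ, LinearMap.BilinForm.apply_toDual_symm_apply, hφ.gradient_lie]
    refine hnd.1 _ fun y => ?_
    have h1 := h y
    rw [← lie_skew, map_neg, neg_eq_zero] at h1
    rw [← lie_skew, map_neg, LinearMap.neg_apply, killingForm_lie_left, h1]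
    simp

theorem partialP_comp_newLax {φ : 𝔤 → ℝ} (hφ : IsInvariantPolynomial φ) {z : PhaseSpace ι} {ξ : 𝔤}
    (hξ : ∀ y, polyGradient φ (T.newLax β b z) y = killingForm ℝ 𝔤 ξ y) (i : ι) :
    partialP (φ ∘ T.newLax β b) i z = killingForm ℝ 𝔤 ξ (T.h i : 𝔤) -
      partialP (T.newHamiltonian β b) i z / T.a β * killingForm ℝ 𝔤 ξ (T.e β) := by
  rw [partialP, (hasFDerivAt_comp_polynomial hφ.polynomial
    (fun ℓ => T.hasFDerivAt_newLax β b ℓ z)).fderiv]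
  simp [hξ, dNewLax_single_left]

theorem partialQ_comp_newLax {φ : 𝔤 → ℝ} (hφ : IsInvariantPolynomial φ) {z : PhaseSpace ι} {ξ : 𝔤}
    (hξ : ∀ y, polyGradient φ (T.newLax β b z) y = killingForm ℝ 𝔤 ξ y) (i : ι) :
    partialQ (φ ∘ T.newLax β b) i z =
      ∑ α, T.a α * T.expRoot α z * α.1.1 (T.dualH i) * killingForm ℝ 𝔤 ξ (T.f α) -
      partialQ (T.newHamiltonian β b) i z / T.a β * killingForm ℝ 𝔤 ξ (T.e β) := by
  rw [partialQ, (hasFDerivAt_comp_polynomial hφ.polynomial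
    (fun ℓ => T.hasFDerivAt_newLax β b ℓ z)).fderiv]
  simp [hξ, dNewLax_single_right]

/-- Each differential splits into the part with the coefficient of `e_β` frozen and a multiple of
`dH̃`. The frozen parts commute by `sum_smul_gradient_eq_zero`; the remaining terms are brackets
with `H̃`, zero by the Lax equation. -/
theorem poisson_comp_newLax_comp_newLax (hβ : T.a β ≠ 0) {φ ψ : 𝔤 → ℝ}
    (hφ : IsInvariantPolynomial φ) (hψ : IsInvariantPolynomial ψ) (z : PhaseSpace ι) :
    poisson (φ ∘ T.newLax β b) (ψ ∘ T.newLax β b) z = 0 := by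
  classical
  obtain ⟨ξ, hξ, hξ0⟩ := exists_killing_gradient hφ (T.newLax β b z)
  obtain ⟨η, hη, hη0⟩ := exists_killing_gradient hψ (T.newLax β b z)
  have h1 := poisson_newHamiltonian_comp_newLax T β b hβ hφ z
  have h2 := poisson_newHamiltonian_comp_newLax T β b hβ hψ z
  have key := T.sum_smul_gradient_eq_zero (fun α => T.a α * T.expRoot α z)
    (fun α => 1 - if α = β then T.newHamiltonian β b z / T.a β else 0) (T.p z)
    (T.newLax β b z) ξ η (by
      rw [newLax, lax]
      simp only [sub_smul, one_smul, Finset.sum_sub_distrib, ite_smul, zero_smul,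
        Finset.sum_ite_eq', Finset.mem_univ, if_true]
      abel) hξ0 hη0
  rw [poisson] at h1 h2 ⊢
  simp only [partialP_comp_newLax T β b hφ hξ, partialQ_comp_newLax T β b hφ hξ,
    partialP_comp_newLax T β b hψ hη, partialQ_comp_newLax T β b hψ hη] at h1 h2 ⊢
  have hsum : ∀ x y : 𝔤, ∑ i, killingForm ℝ 𝔤 x (T.h i : 𝔤) *
      ∑ α, T.a α * T.expRoot α z * α.1.1 (T.dualH i) * killingForm ℝ 𝔤 y (T.f α) =
      ∑ α, T.a α * T.expRoot α z * (killingForm ℝ 𝔤 x (T.t α : 𝔤) * killingForm ℝ 𝔤 y (T.f α)) := by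
    intro x y
    simp only [Finset.mul_sum]
    rw [Finset.sum_comm]
    refine Finset.sum_congr rfl fun α _ => ?_
    rw [← sum_killing_mul_apply, Finset.sum_mul, Finset.mul_sum]
    exact Finset.sum_congr rfl fun i _ => by ring
  have key' : ∑ i, (killingForm ℝ 𝔤 ξ (T.h i : 𝔤) *
      (∑ α, T.a α * T.expRoot α z * α.1.1 (T.dualH i) * killingForm ℝ 𝔤 η (T.f α)) -
      killingForm ℝ 𝔤 η (T.h i : 𝔤) *
      ∑ α, T.a α * T.expRoot α z * α.1.1 (T.dualH i) * killingForm ℝ 𝔤 ξ (T.f α)) = 0 := by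
    rw [Finset.sum_sub_distrib, hsum, hsum, ← Finset.sum_sub_distrib, ← key]
    exact Finset.sum_congr rfl fun α _ => by ring
  generalize killingForm ℝ 𝔤 ξ (T.e β) = u at *
  generalize killingForm ℝ 𝔤 η (T.e β) = v at *
  -- Here `P`, `Q` stand for the partial derivatives of `H̃`, and `A`, `B`, `A'`, `B'` for the
  -- frozen partial derivatives of the two invariants.
  have : ∀ A B A' B' P Q : ι → ℝ, ∑ i, (P i * (B i - Q i / T.a β * u) -
        Q i * (A i - P i / T.a β * u)) = 0 →
      ∑ i, (P i * (B' i - Q i / T.a β * v) - Q i * (A' i - P i / T.a β * v)) = 0 →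
      ∑ i, (A i * B' i - A' i * B i) = 0 →
      ∑ i, ((A i - P i / T.a β * u) * (B' i - Q i / T.a β * v) -
        (B i - Q i / T.a β * u) * (A' i - P i / T.a β * v)) = 0 := by
    intro A B A' B' P Q h1 h2 h3
    have e : ∑ i, ((A i - P i / T.a β * u) * (B' i - Q i / T.a β * v) -
        (B i - Q i / T.a β * u) * (A' i - P i / T.a β * v)) =
        ∑ i, (A i * B' i - A' i * B i) +
        v / T.a β * ∑ i, (P i * (B i - Q i / T.a β * u) - Q i * (A i - P i / T.a β * u)) -
        u / T.a β * ∑ i, (P i * (B' i - Q i / T.a β * v) - Q i * (A' i - P i / T.a β * v)) := by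
      rw [Finset.mul_sum, Finset.mul_sum, ← Finset.sum_add_distrib, ← Finset.sum_sub_distrib]
      exact Finset.sum_congr rfl fun i _ => by ring
    rw [e, h1, h2, h3]; ring
  exact this _ _ _ _ _ _ h1 h2 key'

end TodaLattice

/-! ### Spectra of elements of `sl₂` -/

section SlTwo

open Module LieModule

variable {L : Type*} [LieRing L] [LieAlgebra ℂ L] [FiniteDimensional ℂ L]

/-- The vectors `(ad e)^k v` have the distinct eigenvalues `μ + 2k`, so one of them is zero by
finite dimension. The last nonzero one is primitive, and its eigenvalue is a natural number. -/
theorem IsSl2Triple.exists_int_of_lie_eq_smul {h e f : L} (t : IsSl2Triple h e f) {v : L} {μ : ℂ}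
    (hv : v ≠ 0) (hμ : ⁅h, v⁆ = μ • v) : ∃ n : ℤ, μ = n := by
  have hpow : ∀ k : ℕ, ⁅h, (toEnd ℂ L L e ^ k) v⁆ = (μ + 2 * k) • (toEnd ℂ L L e ^ k) v := by
    intro k
    induction k with
    | zero => simpa using hμ
    | succ k ih =>
      rw [pow_succ', Module.End.mul_apply, toEnd_apply_apply, leibniz_lie, t.lie_h_e_smul ℂ, ih,
        lie_smul, smul_lie, ← add_smul]
      congr 1
      push_cast; ring
  have hex : ∃ k : ℕ, (toEnd ℂ L L e ^ k) v = 0 := by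
    by_contra! contra
    have hs : (Set.range fun k : ℕ => μ + 2 * (k : ℂ)).Infinite :=
      Set.infinite_range_of_injective fun k l hkl => by simpa using hkl
    have hsub : (Set.range fun k : ℕ => μ + 2 * (k : ℂ)) ⊆
        {z | (toEnd ℂ L L h).HasEigenvalue z} := by
      rintro _ ⟨k, rfl⟩
      exact Module.End.hasEigenvalue_of_hasEigenvector
        ⟨Module.End.mem_eigenspace_iff.2 (hpow k), contra k⟩
    exact hs (Set.Finite.subset (Module.End.finite_hasEigenvalue _) hsub)
  obtain ⟨k, hk, hk'⟩ := Nat.exists_not_and_succ_of_not_zero_of_exists (p := fun k =>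
    (toEnd ℂ L L e ^ k) v = 0) (by simpa using hv) hex
  have P : IsSl2Triple.HasPrimitiveVectorWith t ((toEnd ℂ L L e ^ k) v) (μ + 2 * k) :=
    ⟨hk, hpow k, by rw [pow_succ', Module.End.mul_apply, toEnd_apply_apply] at hk'; exact hk'⟩
  obtain ⟨n, hn⟩ := P.exists_nat
  exact ⟨n - 2 * k, by push_cast; rw [← hn]; ring⟩

/-- In the two-dimensional representation `h + c f + d e` has eigenvalues `±s`, so it is `s` times
the neutral element of another triple. -/
theorem IsSl2Triple.exists_int_mul_of_hasEigenvalue {h e f : L} (t : IsSl2Triple h e f)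
    {c d s : ℂ} (hc : c ≠ 0) (hs : s ≠ 0) (hscd : s ^ 2 = 1 + c * d) {z : ℂ}
    (hz : (toEnd ℂ L L (h + c • f + d • e)).HasEigenvalue z) : ∃ n : ℤ, z = s * n := by
  obtain ⟨v, hv⟩ := hz.exists_hasEigenvector
  have hv0 := hv.2
  have hvz : ⁅h + c • f + d • e, v⁆ = z • v := hv.apply_eq_smul
  by_cases hS : h + c • f + d • e = 0
  · rw [hS, zero_lie] at hvz
    have : z = 0 := by simpa [hv0] using hvz.symm
    exact ⟨0, by simp [this]⟩
  have hd : d = (s ^ 2 - 1) / c := by field_simp; rw [hscd]; ring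
  have r1 := t.lie_e_f
  have r2 := t.lie_h_e_smul ℂ
  have r3 := t.lie_lie_smul_f ℂ
  have r4 : ⁅f, e⁆ = -h := by rw [← lie_skew, r1]
  have r5 : ⁅e, h⁆ = -((2 : ℂ) • e) := by rw [← lie_skew, r2]
  have r6 : ⁅f, h⁆ = (2 : ℂ) • f := by rw [← lie_skew, r3, neg_neg]
  -- As a 2×2 matrix, the raising element is the nilpotent whose image and kernel are the
  -- `s`-eigenline spanned by `(1 + s, c)`. The lowering element comes from `s ↦ -s`, scaled so that
  -- the bracket of the two is the neutral element.
  have t' : IsSl2Triple (s⁻¹ • (h + c • f + d • e))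
      (((1 + s) * c) • h - ((1 + s) ^ 2) • e + (c ^ 2) • f)
      ((-(4 * s ^ 2 * c ^ 2)⁻¹) • (((1 - s) * c) • h - ((1 - s) ^ 2) • e + (c ^ 2) • f)) := by
    constructor
    · exact smul_ne_zero (inv_ne_zero hs) hS
    · simp only [lie_add, add_lie, sub_lie, lie_sub, lie_smul, smul_lie, r1, r2, r3, r4, r5, r6,
        lie_self, hd]
      match_scalars <;> field_simp <;> ring
    · simp only [lie_add, add_lie, lie_sub, lie_smul, smul_lie, r1, r2, r3, r4, r5, r6,
        lie_self, hd]
      match_scalars <;> field_simp <;> ring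
    · simp only [lie_add, add_lie, lie_sub, lie_smul, smul_lie, r1, r2, r3, r4, r5, r6,
        lie_self, hd]
      match_scalars <;> field_simp <;> ring
  obtain ⟨n, hn⟩ := t'.exists_int_of_lie_eq_smul (μ := s⁻¹ * z) hv0
    (by rw [smul_lie, hvz, smul_smul])
  exact ⟨n, by rw [← hn, mul_inv_cancel_left₀ hs]⟩

/-- After complexification `s² = 1 + cd` is negative, so `s` is imaginary and the eigenvalues are
integer multiples of it. -/
theorem IsSl2Triple.re_eq_zero_of_aeval_charpoly {𝔤 : Type*} [LieRing 𝔤] [LieAlgebra ℝ 𝔤]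
    [FiniteDimensional ℝ 𝔤] {h e f : 𝔤} (t : IsSl2Triple h e f) {c d : ℝ} (hcd : 1 + c * d < 0)
    {z : ℂ} (hz : Polynomial.aeval z (LieAlgebra.ad ℝ 𝔤 (h + c • f + d • e)).charpoly = 0) :
    z.re = 0 := by
  have hc : c ≠ 0 := by rintro rfl; norm_num at hcd
  have t' : IsSl2Triple ((1 : ℂ) ⊗ₜ[ℝ] h) ((1 : ℂ) ⊗ₜ[ℝ] e) ((1 : ℂ) ⊗ₜ[ℝ] f) := by
    constructor
    · intro h0
      exact t.h_ne_zero ((Module.FaithfullyFlat.one_tmul_eq_zero_iff ℝ 𝔤 h).1 h0)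
    · simp [t.lie_e_f]
    · simp [t.lie_h_e_nsmul, two_smul, TensorProduct.tmul_add]
    · simp [t.lie_h_f_nsmul, two_smul, TensorProduct.tmul_add, TensorProduct.tmul_neg]
  have hS : (1 : ℂ) ⊗ₜ[ℝ] h + (c : ℂ) • ((1 : ℂ) ⊗ₜ[ℝ] f) + (d : ℂ) • ((1 : ℂ) ⊗ₜ[ℝ] e) =
      (1 : ℂ) ⊗ₜ[ℝ] (h + c • f + d • e) := by
    simp [TensorProduct.tmul_add, TensorProduct.smul_tmul', TensorProduct.tmul_smul]
  set r : ℝ := Real.sqrt (-(1 + c * d)) with hr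
  have hr2 : r ^ 2 = -(1 + c * d) := Real.sq_sqrt (by linarith)
  have hr0 : r ≠ 0 := by intro h0; rw [h0] at hr2; norm_num at hr2; linarith
  have hev : (toEnd ℂ (TensorProduct ℝ ℂ 𝔤) (TensorProduct ℝ ℂ 𝔤)
      ((1 : ℂ) ⊗ₜ[ℝ] h + (c : ℂ) • ((1 : ℂ) ⊗ₜ[ℝ] f) +
      (d : ℂ) • ((1 : ℂ) ⊗ₜ[ℝ] e))).HasEigenvalue z := by
    rw [hS, LieModule.toEnd_baseChange, Module.End.hasEigenvalue_iff_isRoot_charpoly,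
      LinearMap.charpoly_baseChange, Polynomial.IsRoot.def, Polynomial.eval_map_algebraMap]
    exact hz
  obtain ⟨n, hn⟩ := t'.exists_int_mul_of_hasEigenvalue (s := r * Complex.I)
    (by exact_mod_cast hc) (by simpa using hr0)
    (by rw [mul_pow, Complex.I_sq]
        have : (r : ℂ) ^ 2 = -(1 + c * d) := by exact_mod_cast hr2
        rw [this]; ring) hev
  rw [hn]
  simp

end SlTwo

/-! ### Projections as polynomials in an operator -/

section Projection

open Polynomial

variable {V : Type*} [AddCommGroup V] [Module ℝ V] [FiniteDimensional ℝ V]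

/-- On the `μ`-eigenspace of `P` the operator `P + B` acts as `μ + B`, hence is annihilated by
`χ_B(X - μ)`, whose complex roots have real part `μ`. For distinct `μ` these polynomials are
coprime, and a Bézout identity gives the projection. -/
theorem exists_polynomial_projection {P B : Module.End ℝ V} (hPB : Commute P B)
    (hB : ∀ z : ℂ, aeval z B.charpoly = 0 → z.re = 0) (μ₀ : ℝ) :
    ∃ π : ℝ[X], ∀ μ x, P x = μ • x → aeval (P + B) π x = if μ = μ₀ then x else 0 := by
  classical
  set Λ : Finset ℝ := (Module.End.finite_hasEigenvalue P).toFinset with hΛ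
  set R : ℝ → ℝ[X] := fun μ => B.charpoly.comp (X - C μ) with hR
  have hzero : ∀ μ x, P x = μ • x → aeval (P + B) (R μ) x = 0 := by
    intro μ x hx
    have hpow : ∀ k : ℕ, ((P + B - algebraMap ℝ (Module.End ℝ V) μ) ^ k) x = (B ^ k) x := by
      intro k
      induction k with
      | zero => simp
      | succ k ih =>
        have hc : P ((B ^ k) x) = μ • (B ^ k) x := by
          have := congrArg (fun f : Module.End ℝ V => f x) (hPB.pow_right k).eq
          simp only [Module.End.mul_apply] at this
          rw [this, hx, map_smul]
        rw [pow_succ', Module.End.mul_apply, ih, pow_succ', Module.End.mul_apply]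
        simp [hc, Module.algebraMap_end_apply]
    have haev : ∀ Q : ℝ[X], aeval (P + B - algebraMap ℝ (Module.End ℝ V) μ) Q x = aeval B Q x := by
      intro Q
      induction Q using Polynomial.induction_on' with
      | add p q hp hq => simp [hp, hq]
      | monomial k a => simp [aeval_monomial, hpow]
    have : aeval (P + B) (R μ) = aeval (P + B - algebraMap ℝ (Module.End ℝ V) μ) B.charpoly := by
      simp [hR, aeval_comp]
    rw [this, haev, LinearMap.aeval_self_charpoly]
    simp
  have hcop : ∀ μ ν, μ ≠ ν → IsCoprime (R μ) (R ν) := by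
    intro μ ν hne
    rw [isCoprime_iff_aeval_ne_zero_of_isAlgClosed ℝ ℂ]
    intro z
    by_contra! hz
    obtain ⟨h1, h2⟩ := hz
    rw [hR] at h1 h2
    simp only [aeval_comp, map_sub, aeval_X, aeval_C] at h1 h2
    have e1 := hB _ h1
    have e2 := hB _ h2
    simp at e1 e2
    exact hne (by linarith)
  have hcop' : IsCoprime (R μ₀) (∏ ν ∈ Λ.erase μ₀, R ν) :=
    IsCoprime.prod_right fun ν hν => hcop _ _ (Finset.ne_of_mem_erase hν).symm
  obtain ⟨a, q, haq⟩ := hcop'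
  -- This Bézout summand kills the eigenspaces for `ν ≠ μ₀` and is `1` modulo `R μ₀`.
  refine ⟨q * ∏ ν ∈ Λ.erase μ₀, R ν, fun μ x hx => ?_⟩
  by_cases hx0 : x = 0
  · simp [hx0]
  have hμ : μ ∈ Λ := by
    rw [hΛ, Set.Finite.mem_toFinset]
    exact Module.End.hasEigenvalue_of_hasEigenvector ⟨Module.End.mem_eigenspace_iff.2 hx, hx0⟩
  split_ifs with h
  · subst h
    have : q * ∏ ν ∈ Λ.erase μ, R ν = 1 - a * R μ := by rw [← haq]; ring
    rw [this]
    simp [hzero μ x hx]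
  · rw [← Finset.mul_prod_erase _ _ (Finset.mem_erase.2 ⟨h, hμ⟩), mul_comm (R μ), ← mul_assoc]
    simp [hzero μ x hx]

theorem exists_derivative_eq (π : ℝ[X]) : ∃ F : ℝ[X], derivative F = π := by
  induction π using Polynomial.induction_on' with
  | add p q hp hq =>
    obtain ⟨F, rfl⟩ := hp
    obtain ⟨G, rfl⟩ := hq
    exact ⟨F + G, derivative_add⟩
  | monomial k a =>
    refine ⟨monomial (k + 1) (a / (k + 1)), ?_⟩
    rw [derivative_monomial]
    push_cast
    rw [div_mul_cancel₀ _ (by positivity)]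

end Projection

/-! ### Traces in the adjoint representation -/

section AdjointTrace

open Polynomial

variable {𝔤 : Type*} [LieRing 𝔤] [LieAlgebra ℝ 𝔤] [FiniteDimensional ℝ 𝔤]

variable (𝔤) in
/-- The matrix of `ad x`, as a linear function of `x`. -/
def adMatrix : 𝔤 →ₗ[ℝ] Matrix (Fin (Module.finrank ℝ 𝔤)) (Fin (Module.finrank ℝ 𝔤)) ℝ where
  toFun x := LinearMap.toMatrixAlgEquiv (Module.finBasis ℝ 𝔤) (LieAlgebra.ad ℝ 𝔤 x)
  map_add' x y := by simp
  map_smul' c x := by simp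

theorem adMatrix_apply (x : 𝔤) : adMatrix 𝔤 x =
    LinearMap.toMatrixAlgEquiv (Module.finBasis ℝ 𝔤) (LieAlgebra.ad ℝ 𝔤 x) := rfl

theorem adMatrix_lie (x y : 𝔤) :
    adMatrix 𝔤 ⁅x, y⁆ = adMatrix 𝔤 x * adMatrix 𝔤 y - adMatrix 𝔤 y * adMatrix 𝔤 x := by
  have h : LieAlgebra.ad ℝ 𝔤 ⁅x, y⁆ =
      LieAlgebra.ad ℝ 𝔤 x * LieAlgebra.ad ℝ 𝔤 y - LieAlgebra.ad ℝ 𝔤 y * LieAlgebra.ad ℝ 𝔤 x := by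
    ext z
    simp
  rw [adMatrix_apply, h, map_sub, map_mul, map_mul]
  rfl

theorem trace_aeval_adMatrix_mul (F : ℝ[X]) (x : 𝔤) (f : Module.End ℝ 𝔤) :
    (aeval (adMatrix 𝔤 x) F * LinearMap.toMatrixAlgEquiv (Module.finBasis ℝ 𝔤) f).trace =
      LinearMap.trace ℝ 𝔤 (aeval (LieAlgebra.ad ℝ 𝔤 x) F * f) := by
  rw [adMatrix_apply, aeval_algHom_apply, ← map_mul,
    LinearMap.trace_eq_matrix_trace ℝ (Module.finBasis ℝ 𝔤)]
  rfl

/-- The function `x ↦ tr F(ad x)`. -/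
def adTrace (F : ℝ[X]) (x : 𝔤) : ℝ := (aeval (adMatrix 𝔤 x) F).trace

theorem hasDerivAt_adTrace (F : ℝ[X]) {C : ℝ → 𝔤} {C' : 𝔤} {s : ℝ}
    (hC : ∀ ℓ : Module.Dual ℝ 𝔤, HasDerivAt (fun t => ℓ (C t)) (ℓ C') s) :
    HasDerivAt (fun t => adTrace F (C t))
      ((aeval (adMatrix 𝔤 (C s)) (derivative F) * adMatrix 𝔤 C').trace) s :=
  hasDerivAt_trace_aeval (fun i j => hC (Matrix.entryLinearMap ℝ ℝ i j ∘ₗ adMatrix 𝔤)) F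

/-- Infinitesimal invariance is `tr (F'(ad x) [ad y, ad x]) = 0`, true by cyclicity since `F'(ad x)`
commutes with `ad x`. -/
theorem isInvariantPolynomial_adTrace (F : ℝ[X]) :
    IsInvariantPolynomial (adTrace F : 𝔤 → ℝ) where
  polynomial := by
    set A := Algebra.adjoin ℝ (Set.range fun f : Module.Dual ℝ 𝔤 => (f : 𝔤 → ℝ)) with hA
    have hent : ∀ (k : ℕ) i j, (fun x => (adMatrix 𝔤 x ^ k) i j) ∈ A := by
      intro k
      induction k with
      | zero =>
        intro i j
        simp only [pow_zero]
        exact A.algebraMap_mem ((1 : Matrix _ _ ℝ) i j)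
      | succ k ih =>
        intro i j
        have : (fun x => (adMatrix 𝔤 x ^ (k + 1)) i j) =
            ∑ m, (fun x => (adMatrix 𝔤 x ^ k) i m) * fun x => adMatrix 𝔤 x m j := by
          ext x
          simp [pow_succ, Matrix.mul_apply]
        rw [this]
        exact A.sum_mem fun m _ => A.mul_mem (ih i m) (Algebra.subset_adjoin
          ⟨Matrix.entryLinearMap ℝ ℝ m j ∘ₗ adMatrix 𝔤, rfl⟩)
    induction F using Polynomial.induction_on' with
    | add p q hp hq =>
      have : (adTrace (p + q) : 𝔤 → ℝ) = adTrace p + adTrace q := by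
        ext x; simp [adTrace]
      rw [this]
      exact A.add_mem hp hq
    | monomial k a =>
      have : (adTrace (monomial k a) : 𝔤 → ℝ) =
          a • ∑ i, fun x => (adMatrix 𝔤 x ^ k) i i := by
        ext x; simp [adTrace, aeval_monomial, ← Algebra.smul_def, Matrix.trace, Finset.mul_sum]
      rw [this]
      exact A.smul_mem (A.sum_mem fun i _ => hent k i i) a
  invariant x y := by
    have h := hasDerivAt_adTrace F (C := fun s : ℝ => x + s • ⁅y, x⁆) (C' := ⁅y, x⁆) (s := 0)
      (fun ℓ => by
        have h1 := ((hasDerivAt_id (0 : ℝ)).mul_const (ℓ ⁅y, x⁆)).const_add (ℓ x)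
        simpa using h1)
    refine h.congr_deriv ?_
    have hcomm : Commute (aeval (adMatrix 𝔤 x) (derivative F)) (adMatrix 𝔤 x) :=
      by
        have := congrArg (aeval (adMatrix 𝔤 x)) (mul_comm (derivative F) X)
        simpa [Commute, SemiconjBy] using this
    simp only [zero_smul, add_zero]
    rw [adMatrix_lie, mul_sub, Matrix.trace_sub, ← mul_assoc, ← mul_assoc, hcomm.eq,
      Matrix.trace_mul_cycle, sub_self]

end AdjointTrace

/-! ### Functional independence -/

namespace IsInvariantPolynomial

variable {𝔤 : Type*} [LieRing 𝔤] [LieAlgebra ℝ 𝔤] [FiniteDimensional ℝ 𝔤] {φ : 𝔤 → ℝ}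

/-- Values of invariants do not change when opposite degrees are rescaled inversely. -/
theorem apply_add_smul (hφ : IsInvariantPolynomial φ) {ρ x y w : 𝔤} (hx : ⁅ρ, x⁆ = 0)
    (hy : ⁅ρ, y⁆ = y) (hw : ⁅ρ, w⁆ = -w) {δ : ℝ} (hδ : 0 < δ) :
    φ (x + y + (δ ^ 2) • w) = φ (x + δ • y + δ • w) := by
  -- This is the orbit of `x + y + δ² w` under `exp (s ad ρ)`, so `X' = [ρ, X]` and the invariant is
  -- constant along it. The value `s = log δ` balances the two coefficients.
  set X : ℝ → 𝔤 := fun s => x + Real.exp s • y + (Real.exp (-s) * δ ^ 2) • w with hX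
  have hder : ∀ s, HasDerivAt (fun s => φ (X s)) 0 s := by
    intro s
    have h := hasFDerivAt_comp_polynomial hφ.polynomial (X := X)
      (X' := LinearMap.toSpanSingleton ℝ 𝔤 ⁅ρ, X s⁆) (z := s) (fun ℓ => by
        have h1 : HasDerivAt (fun s => ℓ (X s))
            (Real.exp s * ℓ y + (Real.exp (-s) * -1) * δ ^ 2 * ℓ w) s := by
          simp only [hX, map_add, map_smul, smul_eq_mul]
          have e1 := ((Real.hasDerivAt_exp s).mul_const (ℓ y)).const_add (ℓ x)
          have e2 := (((hasDerivAt_neg s).exp).mul_const (δ ^ 2)).mul_const (ℓ w)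
          exact e1.add e2
        refine HasFDerivAt.congr_fderiv h1.hasFDerivAt ?_
        ext
        simp [hX, hx, hy, hw])
    have h1 := h.hasDerivAt
    simp only [LinearMap.coe_toContinuousLinearMap', LinearMap.comp_apply,
      LinearMap.toSpanSingleton_apply, one_smul, hφ.gradient_lie] at h1
    exact h1
  have hconst := is_const_of_deriv_eq_zero (f := fun s => φ (X s))
    (fun s => (hder s).differentiableAt) (fun s => (hder s).deriv) 0 (Real.log δ)
  have e : δ⁻¹ * δ ^ 2 = δ := by field_simp
  simpa only [hX, Real.exp_zero, inv_one, one_smul, one_mul, Real.exp_neg, Real.exp_log hδ,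
    e] using hconst

end IsInvariantPolynomial

section

variable {𝔤 : Type*} [LieRing 𝔤] [LieAlgebra ℝ 𝔤] [FiniteDimensional ℝ 𝔤]

theorem ad_mul_sub (x y : 𝔤) : LieAlgebra.ad ℝ 𝔤 ⁅x, y⁆ =
    LieAlgebra.ad ℝ 𝔤 x * LieAlgebra.ad ℝ 𝔤 y - LieAlgebra.ad ℝ 𝔤 y * LieAlgebra.ad ℝ 𝔤 x := by
  ext z
  simp

theorem trace_mul_ad_lie {D : Module.End ℝ 𝔤} {x : 𝔤} (h : Commute D (LieAlgebra.ad ℝ 𝔤 x))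
    (y : 𝔤) : LinearMap.trace ℝ 𝔤 (D * LieAlgebra.ad ℝ 𝔤 ⁅x, y⁆) = 0 := by
  rw [ad_mul_sub, mul_sub, map_sub, ← mul_assoc, ← mul_assoc, h.eq, mul_assoc,
    LinearMap.trace_mul_comm, sub_self]

end

/-! ### The base point and the polynomials that separate the simple roots. -/

namespace TodaLattice

open LieAlgebra LieAlgebra.IsKilling LieModule

variable {𝔤 : Type*} [LieRing 𝔤] [LieAlgebra ℝ 𝔤] [FiniteDimensional ℝ 𝔤]
  [LieAlgebra.IsSimple ℝ 𝔤] {𝔞 : LieSubalgebra ℝ 𝔤} [𝔞.IsCartanSubalgebra]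
  [LieModule.IsTriangularizable ℝ 𝔞 𝔤] {ι : Type*} [Fintype ι] [DecidableEq ι]
  (T : TodaLattice 𝔞 ι) (β : T.simple.support) (b : ℝ)

/-- Half the square of the length of the root `β`. -/
def halfNormSq : ℝ := β.1.1 (T.t β) / 2

theorem halfNormSq_pos : 0 < T.halfNormSq β := by
  have h : 0 < killingForm ℝ 𝔤 (T.t β : 𝔤) (T.t β : 𝔤) :=
    killingForm_self_pos β.1.1
      (root_apply_cartanEquivDual_symm_ne_zero (𝔞.isNonZero_coe_root β.1))
  rw [T.killing_t] at h
  exact half_pos h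

/-- The coroot of `β`. -/
def simpleCoroot : 𝔞 := (T.halfNormSq β)⁻¹ • T.t β

theorem killing_simpleCoroot (x : 𝔞) :
    killingForm ℝ 𝔤 (T.simpleCoroot β : 𝔤) (x : 𝔤) = (T.halfNormSq β)⁻¹ * β.1.1 x := by
  rw [← T.killing_t]
  simp [simpleCoroot]

theorem simple_apply_simpleCoroot : β.1.1 (T.simpleCoroot β) = 2 := by
  have h := (T.halfNormSq_pos β).ne'
  have : β.1.1 (T.t β) = 2 * T.halfNormSq β := by rw [halfNormSq]; ring
  rw [simpleCoroot, ← Weight.toLinear_apply, map_smul, Weight.toLinear_apply, this, smul_eq_mul]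
  field_simp

theorem isSl2Triple_simpleCoroot :
    IsSl2Triple (T.simpleCoroot β : 𝔤) (T.e β) ((T.halfNormSq β)⁻¹ • T.f β) where
  h_ne_zero h := by
    have := T.simple_apply_simpleCoroot β
    rw [show T.simpleCoroot β = 0 from Subtype.ext h, ← Weight.toLinear_apply, map_zero] at this
    norm_num at this
  lie_e_f := by rw [lie_smul, T.lie_e_f]; rfl
  lie_h_e_nsmul := by
    rw [T.lie_e, T.simple_apply_simpleCoroot, two_smul, two_smul]
  lie_h_f_nsmul := by
    rw [lie_smul, T.lie_f, T.simple_apply_simpleCoroot, smul_neg, smul_comm, two_smul, two_smul]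

/-- A large generic element of the hyperplane `β = 0`. -/
theorem exists_generic : ∃ x : 𝔞, β.1.1 x = 0 ∧
    (∀ α : T.simple.support, α ≠ β → ∀ γ : Weight ℝ 𝔞 𝔤, γ x = α.1.1 x →
      ∀ α', α' ≠ β → γ (coweight T.simple α') = α.1.1 (coweight T.simple α')) ∧
    ∀ α : T.simple.support, α ≠ β → 0 < killingForm ℝ 𝔤 (x : 𝔤) (x : 𝔤) + 2 * b := by
  classical
  let kerβ : Submodule ℝ 𝔞 := LinearMap.ker β.1.1.toLinear
  -- Pairs `(γ, α)` whose difference is not identically zero on the kernel of `β`. There are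
  -- finitely many, so some vector of the kernel avoids all the corresponding proper subspaces.
  let J := {w : Weight ℝ 𝔞 𝔤 × T.simple.support //
    ∃ y ∈ kerβ, (w.1.toLinear - w.2.1.1.toLinear) y ≠ 0}
  obtain ⟨x₀, hx₀, hne⟩ := Module.Dual.exists_forall_mem_ne_zero_of_forall_exists kerβ
    (fun j : J => j.1.1.toLinear - j.1.2.1.1.toLinear) (fun j => j.2)
  have hβ0 : β.1.1 x₀ = 0 := by simpa [kerβ] using hx₀
  have hcow : ∀ α' : T.simple.support, α' ≠ β → coweight T.simple α' ∈ kerβ := fun α' h => by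
    simpa [kerβ] using simple_apply_coweight_of_ne T.simple h.symm
  have hgen : ∀ (α : T.simple.support) (γ : Weight ℝ 𝔞 𝔤), γ x₀ = α.1.1 x₀ →
      ∀ y ∈ kerβ, γ y = α.1.1 y := by
    intro α γ h y hy
    by_contra hcon
    have := hne ⟨(γ, α), y, hy, by simpa [sub_eq_zero] using hcon⟩
    simp [h] at this
  set κ := killingForm ℝ 𝔤 (x₀ : 𝔤) (x₀ : 𝔤) with hκ
  have hκpos : ∀ α : T.simple.support, α ≠ β → 0 < κ := by
    intro α hα
    refine killingForm_self_pos α.1.1 fun h0 => ?_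
    have := hgen α β.1.1 (by rw [hβ0, h0]) _ (hcow α hα)
    rw [simple_apply_coweight_of_ne T.simple hα.symm, simple_apply_coweight_self] at this
    norm_num at this
  -- Chosen so that `r κ = κ + 2|b|`. In rank one the kernel of `β` is zero and `κ` may vanish; then
  -- there is no `α ≠ β`, and only `r ≠ 0` matters.
  set r : ℝ := 1 + 2 * |b| / |κ| with hr
  have hr1 : 1 ≤ r := by
    have : 0 ≤ 2 * |b| / |κ| := by positivity
    linarith
  have hr0 : r ≠ 0 := by linarith
  have hsmul : ∀ γ : Weight ℝ 𝔞 𝔤, γ (r • x₀) = r * γ x₀ := fun γ => by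
    rw [← Weight.toLinear_apply, map_smul]; rfl
  refine ⟨r • x₀, by rw [hsmul, hβ0, mul_zero], ?_, ?_⟩
  · intro α _ γ h α' hα'
    rw [hsmul, hsmul] at h
    exact hgen α γ (mul_left_cancel₀ hr0 h) _ (hcow α' hα')
  · intro α hα
    have hκ0 := hκpos α hα
    have e : killingForm ℝ 𝔤 ((r • x₀ : 𝔞) : 𝔤) ((r • x₀ : 𝔞) : 𝔤) = r * (r * κ) := by
      simp [hκ]
    have e2 : r * κ = κ + 2 * |b| := by
      rw [hr, abs_of_pos hκ0]; field_simp
    have h3 : r * κ ≤ r * (r * κ) := le_mul_of_one_le_left (by positivity) hr1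
    rw [e]
    have := neg_abs_le b
    linarith

/-- The polynomials in the adjoint operator of a base point which separate the simple roots. -/
theorem exists_separating_polynomial {x : 𝔞} (hx : β.1.1 x = 0)
    (hgen : ∀ α : T.simple.support, α ≠ β → ∀ γ : Weight ℝ 𝔞 𝔤, γ x = α.1.1 x →
      ∀ α', α' ≠ β → γ (coweight T.simple α') = α.1.1 (coweight T.simple α'))
    {c d : ℝ} (hcd : 1 + T.halfNormSq β * c * d < 0) (α : T.simple.support) (hα : α ≠ β) :
    ∃ (π : Polynomial ℝ) (D : Module.End ℝ 𝔤), D = Polynomial.aeval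
        (ad ℝ 𝔤 ((x : 𝔤) + ((T.simpleCoroot β : 𝔤) + c • T.f β + d • T.e β))) π ∧
      LinearMap.trace ℝ 𝔤 (D * ad ℝ 𝔤 (T.simpleCoroot β)) = 0 ∧
      LinearMap.trace ℝ 𝔤 (D * ad ℝ 𝔤 (T.e β)) = 0 ∧
      (∀ α', α' ≠ β → α' ≠ α →
        LinearMap.trace ℝ 𝔤 (D * ad ℝ 𝔤 (coweight T.simple α')) = 0) ∧
      LinearMap.trace ℝ 𝔤 (D * ad ℝ 𝔤 (coweight T.simple α)) ≠ 0 := by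
  have hk := (T.halfNormSq_pos β).ne'
  have ht := T.isSl2Triple_simpleCoroot β
  set S : 𝔤 := (T.simpleCoroot β : 𝔤) + c • T.f β + d • T.e β with hS
  have hS' : S = (T.simpleCoroot β : 𝔤) + (T.halfNormSq β * c) • ((T.halfNormSq β)⁻¹ • T.f β) +
      d • T.e β := by
    rw [smul_smul, mul_comm (T.halfNormSq β), mul_assoc, mul_inv_cancel₀ hk, mul_one]
  have h0 : ∀ y : 𝔞, ⁅(x : 𝔤), (y : 𝔤)⁆ = 0 := fun y => by
    rw [lie_of_mem_rootSpace (coe_mem_rootSpace_zero y)]; simp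
  have hxe : ⁅(x : 𝔤), T.e β⁆ = 0 := by rw [T.lie_e, hx, zero_smul]
  have hxf : ⁅(x : 𝔤), T.f β⁆ = 0 := by rw [T.lie_f, hx, zero_smul, neg_zero]
  have hcomm : ∀ y : 𝔤, ⁅(x : 𝔤), y⁆ = 0 → Commute (ad ℝ 𝔤 (x : 𝔤)) (ad ℝ 𝔤 y) := by
    intro y hy
    have := ad_mul_sub (x : 𝔤) y
    rw [hy, map_zero] at this
    exact (sub_eq_zero.1 this.symm)
  have hxS : ⁅(x : 𝔤), S⁆ = 0 := by simp [hS, h0, hxe, hxf]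
  -- `D` will be the projection onto the `α(x)`-eigenspace of `ad x`, although it is a polynomial in
  -- `ad (x + S)`.
  obtain ⟨π, hπ⟩ := exists_polynomial_projection (hcomm S hxS)
    (fun z hz => by
      rw [hS'] at hz
      exact ht.re_eq_zero_of_aeval_charpoly hcd hz) (α.1.1 x)
  rw [← map_add] at hπ
  set D := Polynomial.aeval (ad ℝ 𝔤 ((x : 𝔤) + S)) π with hD
  have hDγ : ∀ (γ : Weight ℝ 𝔞 𝔤), ∀ y ∈ rootSpace 𝔞 γ, D y = if γ x = α.1.1 x then y else 0 :=
    fun γ y hy => hπ (γ x) y (lie_of_mem_rootSpace hy x)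
  have hDcomm : ∀ u : 𝔤, ⁅(x : 𝔤), u⁆ = 0 → Commute D (ad ℝ 𝔤 u) := by
    intro u hu
    refine LinearMap.ext fun y => ?_
    induction y using rootSpace_induction 𝔞 with
    | zero => simp
    | add y y' h h' => rw [map_add, map_add, h, h']
    | mem γ y hy =>
      have h1 : ⁅(x : 𝔤), y⁆ = γ x • y := lie_of_mem_rootSpace hy x
      have h2 : ad ℝ 𝔤 (x : 𝔤) ⁅u, y⁆ = γ x • ⁅u, y⁆ := by
        rw [ad_apply, leibniz_lie, hu, zero_lie, zero_add, h1, lie_smul]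
      rw [Module.End.mul_apply, Module.End.mul_apply, ad_apply, ad_apply, hπ _ _ h2, hDγ γ y hy]
      split_ifs <;> simp
  have hDcow : ∀ α', α' ≠ β →
      D * ad ℝ 𝔤 (coweight T.simple α' : 𝔤) = α.1.1 (coweight T.simple α') • D := by
    intro α' hα'
    refine LinearMap.ext fun y => ?_
    induction y using rootSpace_induction 𝔞 with
    | zero => simp
    | add y y' h h' => rw [map_add, map_add, h, h']
    | mem γ y hy =>
      rw [Module.End.mul_apply, ad_apply, lie_of_mem_rootSpace hy, map_smul, LinearMap.smul_apply,
        hDγ γ y hy]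
      split_ifs with h
      · rw [hgen α hα γ h α' hα']
      · simp
  -- The coroot and `e_β` are commutators with an element whose adjoint commutes with `D`, so their
  -- traces vanish. By genericity a coweight `α' ≠ β` acts on the range of `D` as the scalar
  -- `α(coweight α')`; for `α' = α` the trace is that of an idempotent which fixes `e_α`.
  refine ⟨π, D, rfl, ?_, ?_, ?_, ?_⟩
  · rw [← ht.lie_e_f]
    exact trace_mul_ad_lie (hDcomm _ hxe) _
  · have h2 : T.e β = (2⁻¹ : ℝ) • ⁅(T.simpleCoroot β : 𝔤), T.e β⁆ := by
      rw [ht.lie_h_e_smul ℝ, smul_smul]; norm_num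
    rw [h2, ← lie_smul]
    exact trace_mul_ad_lie (hDcomm _ (h0 _)) _
  · intro α' hα' hne
    rw [hDcow α' hα', simple_apply_coweight_of_ne T.simple hne.symm]
    simp
  · rw [hDcow α hα, simple_apply_coweight_self, one_smul]
    have hidem : IsIdempotentElem D := by
      refine LinearMap.ext fun y => ?_
      induction y using rootSpace_induction 𝔞 with
      | zero => simp
      | add y y' h h' => rw [map_add, map_add, h, h']
      | mem γ y hy =>
        rw [Module.End.mul_apply, hDγ γ y hy]
        split_ifs with h
        · rw [hDγ γ y hy, if_pos h]
        · simp
    rw [ne_eq, LinearMap.IsIdempotentElem.trace_eq_zero_iff hidem]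
    intro h
    have := hDγ α.1.1 _ (T.e_mem α)
    rw [if_pos rfl, h] at this
    exact T.e_ne_zero α this.symm

end TodaLattice

/-! ### Degeneration in which the simple roots other than `β` decouple. -/

namespace TodaLattice

open LieAlgebra LieAlgebra.IsKilling LieModule

variable {𝔤 : Type*} [LieRing 𝔤] [LieAlgebra ℝ 𝔤] [FiniteDimensional ℝ 𝔤]
  [LieAlgebra.IsSimple ℝ 𝔤] {𝔞 : LieSubalgebra ℝ 𝔤} [𝔞.IsCartanSubalgebra]
  [LieModule.IsTriangularizable ℝ 𝔞 𝔤] {ι : Type*} [Fintype ι] [DecidableEq ι]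
  (T : TodaLattice 𝔞 ι) (β : T.simple.support) (b : ℝ)

/-- The point of the phase space with momentum `u` and position `v`. -/
def point (u v : 𝔞) : PhaseSpace ι := (fun i => T.h.repr u i, fun i => T.dualH.repr v i)

theorem p_point (u v : 𝔞) : T.p (T.point u v) = u := T.h.sum_repr u

theorem q_point (u v : 𝔞) : T.q (T.point u v) = v := T.dualH.sum_repr v

theorem point_add_smul (u v w : 𝔞) (s : ℝ) :
    T.point u w + s • T.point v 0 = T.point (u + s • v) w := by
  simp only [point, Prod.smul_mk, Prod.mk_add_mk, map_add, map_smul, map_zero]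
  congr 1
  ext i
  simp

open Classical in
/-- The simple roots other than `β`. -/
def otherRoots : Finset T.simple.support := Finset.univ.erase β

theorem mem_otherRoots {α : T.simple.support} : α ∈ T.otherRoots β ↔ α ≠ β := by
  simp [otherRoots]

theorem sum_eq_add_otherRoots {M : Type*} [AddCommMonoid M] (g : T.simple.support → M) :
    ∑ α, g α = g β + ∑ α ∈ T.otherRoots β, g α := by
  classical
  exact (Finset.add_sum_erase _ _ (Finset.mem_univ β)).symm

/-- The sum of the fundamental coweights other than that of `β`. -/
def partialHeightElt : 𝔞 := ∑ α ∈ T.otherRoots β, coweight T.simple α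

theorem apply_partialHeightElt {α : T.simple.support} (hα : α ≠ β) :
    α.1.1 (T.partialHeightElt β) = 1 :=
  simple_apply_sum_coweight T.simple α _ ((T.mem_otherRoots β).2 hα)

theorem apply_partialHeightElt_self : β.1.1 (T.partialHeightElt β) = 0 := by
  rw [partialHeightElt, ← Weight.toLinear_apply, map_sum]
  exact Finset.sum_eq_zero fun α hα =>
    simple_apply_coweight_of_ne T.simple ((T.mem_otherRoots β).1 hα).symm

/-- The position at which the exponential of every simple root other than `β` is `δ ^ 2`. -/
def degeneratePosition (δ : ℝ) : 𝔞 := Real.log (δ ^ 2) • T.partialHeightElt β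

theorem expRoot_degenerate {δ : ℝ} (hδ : 0 < δ) (u : 𝔞) {α : T.simple.support} (hα : α ≠ β) :
    T.expRoot α (T.point u (T.degeneratePosition β δ)) = δ ^ 2 := by
  rw [expRoot, q_point, degeneratePosition, ← Weight.toLinear_apply, map_smul,
    Weight.toLinear_apply, T.apply_partialHeightElt β hα, smul_eq_mul, mul_one,
    Real.exp_log (by positivity)]

theorem expRoot_degenerate_self (δ : ℝ) (u : 𝔞) :
    T.expRoot β (T.point u (T.degeneratePosition β δ)) = 1 := by
  rw [expRoot, q_point, degeneratePosition, ← Weight.toLinear_apply, map_smul,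
    Weight.toLinear_apply, T.apply_partialHeightElt_self β, smul_zero, Real.exp_zero]

/-- The value of `H̃` at a degenerate position. -/
def degenerateEnergy (δ : ℝ) (u : 𝔞) : ℝ :=
  1 / 2 * killingForm ℝ 𝔤 (u : 𝔤) (u : 𝔤) + (T.a β + δ ^ 2 * ∑ α ∈ T.otherRoots β, T.a α) + b

theorem newHamiltonian_degenerate {δ : ℝ} (hδ : 0 < δ) (u : 𝔞) :
    T.newHamiltonian β b (T.point u (T.degeneratePosition β δ)) = T.degenerateEnergy β b δ u := by
  rw [newHamiltonian, hamiltonian, T.sum_eq_add_otherRoots β, expRoot_degenerate_self, p_point,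
    degenerateEnergy, Finset.mul_sum, inv_one, one_mul, mul_one]
  congr 3
  exact Finset.sum_congr rfl fun α hα => by
    rw [T.expRoot_degenerate β hδ u ((T.mem_otherRoots β).1 hα), mul_comm]

/-- The Lax matrix at a degenerate position, rescaled. -/
def degenerateLax (δ : ℝ) (u : 𝔞) : 𝔤 :=
  (u : 𝔤) + T.a β • T.f β + (1 - T.degenerateEnergy β b δ u / T.a β) • T.e β +
    δ • (∑ α ∈ T.otherRoots β, T.e α + ∑ α ∈ T.otherRoots β, T.a α • T.f α)

theorem invariant_newLax_degenerate {φ : 𝔤 → ℝ} (hφ : IsInvariantPolynomial φ) {δ : ℝ}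
    (hδ : 0 < δ) (u : 𝔞) :
    φ (T.newLax β b (T.point u (T.degeneratePosition β δ))) = φ (T.degenerateLax β b δ u) := by
  have hρ : ∀ x : 𝔞, ⁅(T.partialHeightElt β : 𝔤), (x : 𝔤)⁆ = 0 := fun x => by
    rw [lie_of_mem_rootSpace (coe_mem_rootSpace_zero x)]; simp
  have h := hφ.apply_add_smul (ρ := (T.partialHeightElt β : 𝔤))
    (x := (u : 𝔤) + T.a β • T.f β + (1 - T.degenerateEnergy β b δ u / T.a β) • T.e β)
    (y := ∑ α ∈ T.otherRoots β, T.e α) (w := ∑ α ∈ T.otherRoots β, T.a α • T.f α)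
    (by simp only [lie_add, lie_smul, T.lie_e, T.lie_f, T.apply_partialHeightElt_self, hρ]; simp)
    (by
      rw [lie_sum]
      exact Finset.sum_congr rfl fun α hα => by
        rw [T.lie_e, T.apply_partialHeightElt β ((T.mem_otherRoots β).1 hα), one_smul])
    (by
      rw [lie_sum, ← Finset.sum_neg_distrib]
      exact Finset.sum_congr rfl fun α hα => by
        rw [lie_smul, T.lie_f, T.apply_partialHeightElt β ((T.mem_otherRoots β).1 hα), one_smul,
          smul_neg])
    hδ
  have e1 : T.newLax β b (T.point u (T.degeneratePosition β δ)) =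
      (u : 𝔤) + T.a β • T.f β + (1 - T.degenerateEnergy β b δ u / T.a β) • T.e β +
      ∑ α ∈ T.otherRoots β, T.e α + δ ^ 2 • ∑ α ∈ T.otherRoots β, T.a α • T.f α := by
    rw [newLax, lax, T.newHamiltonian_degenerate β b hδ, p_point, T.sum_eq_add_otherRoots β,
      T.sum_eq_add_otherRoots β T.e, expRoot_degenerate_self, mul_one, Finset.smul_sum]
    have : ∑ α ∈ T.otherRoots β,
        (T.a α * T.expRoot α (T.point u (T.degeneratePosition β δ))) • T.f α =
        ∑ α ∈ T.otherRoots β, δ ^ 2 • T.a α • T.f α :=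
      Finset.sum_congr rfl fun α hα => by
        rw [T.expRoot_degenerate β hδ u ((T.mem_otherRoots β).1 hα), mul_comm, mul_smul]
    rw [this]
    module
  rw [e1, h, degenerateLax, smul_add, ← add_assoc]

theorem hasDerivAt_degenerateLax (δ : ℝ) (u v : 𝔞) (ℓ : Module.Dual ℝ 𝔤) :
    HasDerivAt (fun s : ℝ => ℓ (T.degenerateLax β b δ (u + s • v)))
      (ℓ ((v : 𝔤) - (killingForm ℝ 𝔤 (u : 𝔤) (v : 𝔤) / T.a β) • T.e β)) 0 := by
  have hE : HasDerivAt (fun s : ℝ => T.degenerateEnergy β b δ (u + s • v))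
      (killingForm ℝ 𝔤 (u : 𝔤) (v : 𝔤)) 0 := by
    have e : (fun s : ℝ => T.degenerateEnergy β b δ (u + s • v)) = fun s =>
        s * killingForm ℝ 𝔤 (u : 𝔤) (v : 𝔤) + (s ^ 2 * (1 / 2 * killingForm ℝ 𝔤 (v : 𝔤) (v : 𝔤)) +
        T.degenerateEnergy β b δ u) := by
      ext s
      simp only [degenerateEnergy, AddMemClass.coe_add, SetLike.val_smul, map_add, map_smul,
        LinearMap.add_apply, LinearMap.smul_apply, smul_eq_mul,
        killingForm_comm (v : 𝔤) (u : 𝔤)]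
      ring
    rw [e]
    have h1 := (hasDerivAt_id (0 : ℝ)).mul_const (killingForm ℝ 𝔤 (u : 𝔤) (v : 𝔤))
    have h2 := (((hasDerivAt_id (0 : ℝ)).pow 2).mul_const
      (1 / 2 * killingForm ℝ 𝔤 (v : 𝔤) (v : 𝔤))).add_const (T.degenerateEnergy β b δ u)
    refine (h1.add h2).congr_deriv ?_
    simp
  have h1 := ((hasDerivAt_id (0 : ℝ)).mul_const (ℓ (v : 𝔤))).const_add (ℓ (u : 𝔤))
  have h2 := (((hE.div_const (T.a β)).const_sub 1).mul_const (ℓ (T.e β)))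
  have h := ((h1.add_const (ℓ (T.a β • T.f β))).add h2).add_const (ℓ (δ •
    (∑ α ∈ T.otherRoots β, T.e α + ∑ α ∈ T.otherRoots β, T.a α • T.f α)))
  refine (h.congr_deriv ?_).congr_of_eventuallyEq (.of_forall fun s => ?_)
  · simp only [map_sub, map_smul, smul_eq_mul]; ring
  · simp only [degenerateLax, map_add, map_smul, smul_eq_mul, AddMemClass.coe_add,
      SetLike.val_smul, Pi.add_apply, id]

/-- Only the momentum varies along this line, so the point stays over the same degenerate position
and the rescaled Lax matrix may be differentiated instead. -/
theorem fderiv_adTrace_newLax (F : Polynomial ℝ) {δ : ℝ} (hδ : 0 < δ) (u v : 𝔞) :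
    fderiv ℝ (adTrace F ∘ T.newLax β b) (T.point u (T.degeneratePosition β δ)) (T.point v 0) =
      (Polynomial.aeval (adMatrix 𝔤 (T.degenerateLax β b δ u)) (Polynomial.derivative F) *
        adMatrix 𝔤 ((v : 𝔤) - (killingForm ℝ 𝔤 (u : 𝔤) (v : 𝔤) / T.a β) • T.e β)).trace := by
  have hinv := isInvariantPolynomial_adTrace (𝔤 := 𝔤) F
  have h1 := (AnalyticAt.comp_polynomial hinv.polynomial fun ℓ => T.analyticAt_newLax β b ℓ
    (T.point u (T.degeneratePosition β δ))).differentiableAt.hasFDerivAt.hasLineDerivAt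
    (T.point v 0)
  have h2 : HasDerivAt (fun s : ℝ => adTrace F (T.degenerateLax β b δ (u + s • v))) _ 0 :=
    hasDerivAt_adTrace F (T.hasDerivAt_degenerateLax β b δ u v)
  rw [zero_smul, add_zero] at h2
  refine HasDerivAt.unique h1 (h2.congr_of_eventuallyEq (.of_forall fun s => ?_))
  beta_reduce
  rw [point_add_smul, Function.comp_apply, T.invariant_newLax_degenerate β b hinv hδ]

theorem fderiv_newHamiltonian_degenerate (δ : ℝ) (u v : 𝔞) :
    fderiv ℝ (T.newHamiltonian β b) (T.point u (T.degeneratePosition β δ)) (T.point v 0) =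
      killingForm ℝ 𝔤 (u : 𝔤) (v : 𝔤) := by
  rw [(T.hasFDerivAt_newHamiltonian β b _).fderiv]
  have h0 : ∀ α, T.rootForm α (T.point v 0) = 0 := fun α => by
    change Weight.toLinear ℝ 𝔞 𝔤 α.1.1 (T.q (T.point v 0)) = 0
    rw [q_point, map_zero]
  simp [dNewHamiltonian, dHamiltonian, h0, kinetic_apply, p_point, expRoot_degenerate_self]

theorem continuous_adMatrix_degenerateLax (u : 𝔞) :
    Continuous fun δ : ℝ => adMatrix 𝔤 (T.degenerateLax β b δ u) := by
  simp only [degenerateLax, degenerateEnergy, map_add, map_smul]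
  fun_prop

open Classical in
-- The Jacobian along momentum directions is continuous in `δ`, and its limit at `δ = 0`, where only
-- the root `β` is left, is diagonal and invertible.
theorem exists_independent (hβ : T.a β ≠ 0) :
    ∃ F : T.simple.support → Polynomial ℝ, Dense {z : PhaseSpace ι | LinearIndependent ℝ
      fun α => fderiv ℝ (if α = β then T.newHamiltonian β b else adTrace (F α) ∘ T.newLax β b) z} := by
  obtain ⟨x, hx, hgen, hlarge⟩ := T.exists_generic β b
  have hk := T.halfNormSq_pos β
  set h : 𝔞 := T.simpleCoroot β with hh
  -- The coroot component contributes exactly `-1` to `|β|²/2 · a_β d`, with `|β|² = β(t_β)`,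
  -- cancelling the `1` in the `sl₂` discriminant. What is left is negative because `K(x, x) + 2b >
  -- 0`.
  set u : 𝔞 := x + h with hu
  set κ := killingForm ℝ 𝔤 (h : 𝔤) (h : 𝔤) with hκ
  have hκ2 : κ * T.halfNormSq β = 2 := by
    rw [hκ, hh, T.killing_simpleCoroot, T.simple_apply_simpleCoroot]
    field_simp
  have hκ0 : κ ≠ 0 := by rintro h0; rw [h0] at hκ2; norm_num at hκ2
  have hxh : killingForm ℝ 𝔤 (x : 𝔤) (h : 𝔤) = 0 := by
    rw [killingForm_comm, hh, T.killing_simpleCoroot, hx, mul_zero]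
  have huh : killingForm ℝ 𝔤 (u : 𝔤) (h : 𝔤) = κ := by
    rw [hu, AddMemClass.coe_add, map_add, LinearMap.add_apply, hxh, zero_add]
  have huu : killingForm ℝ 𝔤 (u : 𝔤) (u : 𝔤) = killingForm ℝ 𝔤 (x : 𝔤) (x : 𝔤) + κ := by
    rw [hu]
    simp only [AddMemClass.coe_add, map_add, LinearMap.add_apply, hxh,
      killingForm_comm (h : 𝔤) (x : 𝔤), zero_add, add_zero]
    rfl
  set d : ℝ := 1 - T.degenerateEnergy β b 0 u / T.a β with hd
  have had : T.a β * d = -(1 / 2 * (killingForm ℝ 𝔤 (x : 𝔤) (x : 𝔤) + κ) + b) := by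
    rw [hd, degenerateEnergy, huu]
    field_simp
    ring
  have hcd : ∀ α : T.simple.support, α ≠ β → 1 + T.halfNormSq β * T.a β * d < 0 := by
    intro α hα
    have h1 := mul_pos hk (hlarge α hα)
    rw [mul_assoc, had]
    nlinarith
  have hlax : T.degenerateLax β b 0 u =
      (x : 𝔤) + ((h : 𝔤) + T.a β • T.f β + d • T.e β) := by
    rw [degenerateLax, hu, AddMemClass.coe_add, zero_smul, add_zero, ← hu]
    abel
  have hsep : ∀ α : T.simple.support, ∃ F : Polynomial ℝ, α ≠ β →
      ∃ D : Module.End ℝ 𝔤, D = Polynomial.aeval (ad ℝ 𝔤 (T.degenerateLax β b 0 u))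
        (Polynomial.derivative F) ∧
      LinearMap.trace ℝ 𝔤 (D * ad ℝ 𝔤 h) = 0 ∧
      LinearMap.trace ℝ 𝔤 (D * ad ℝ 𝔤 (T.e β)) = 0 ∧
      (∀ α', α' ≠ β → α' ≠ α →
        LinearMap.trace ℝ 𝔤 (D * ad ℝ 𝔤 (coweight T.simple α')) = 0) ∧
      LinearMap.trace ℝ 𝔤 (D * ad ℝ 𝔤 (coweight T.simple α)) ≠ 0 := by
    intro α
    by_cases hα : α = β
    · exact ⟨0, fun h => absurd hα h⟩
    obtain ⟨π, D, hD⟩ := T.exists_separating_polynomial β hx hgen (hcd α hα) α hα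
    obtain ⟨F, rfl⟩ := exists_derivative_eq π
    rw [← hlax] at hD
    exact ⟨F, fun _ => ⟨D, hD⟩⟩
  choose F hF using hsep
  refine ⟨F, ?_⟩
  -- The coweights are corrected by multiples of the coroot so that `H̃` has zero derivative along
  -- them. The correction is invisible to the other rows, where the coroot has trace zero against
  -- `D`.
  let v : T.simple.support → 𝔞 := fun α => if α = β then h else coweight T.simple α -
    (killingForm ℝ 𝔤 (u : 𝔤) (coweight T.simple α : 𝔤) / κ) • h
  have huv : ∀ α, α ≠ β → killingForm ℝ 𝔤 (u : 𝔤) (v α : 𝔤) = 0 := by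
    intro α hα
    simp only [v, if_neg hα, AddSubgroupClass.coe_sub, SetLike.val_smul, map_sub, map_smul, huh,
      smul_eq_mul]
    field_simp
    ring
  -- For `δ > 0` this is the Jacobian at a point of the phase space. At `δ = 0` there is no such
  -- point, but the formula still makes sense and is continuous.
  let G : ℝ → Matrix T.simple.support T.simple.support ℝ := fun δ => Matrix.of fun α α' =>
    if α = β then killingForm ℝ 𝔤 (u : 𝔤) (v α' : 𝔤) else
      (Polynomial.aeval (adMatrix 𝔤 (T.degenerateLax β b δ u)) (Polynomial.derivative (F α)) *
        adMatrix 𝔤 ((v α' : 𝔤) - (killingForm ℝ 𝔤 (u : 𝔤) (v α' : 𝔤) / T.a β) • T.e β)).trace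
  have hGcont : Continuous G := by
    refine continuous_matrix fun α α' => ?_
    by_cases hα : α = β
    · simp only [G, hα, Matrix.of_apply, if_true]
      exact continuous_const
    · simp only [G, hα, Matrix.of_apply, if_false]
      exact (((Polynomial.continuous_aeval _).comp
        (T.continuous_adMatrix_degenerateLax β b u)).mul continuous_const).matrix_trace
  have hG0 : (G 0).det ≠ 0 := by
    have hdiag : G 0 = Matrix.diagonal fun α => G 0 α α := by
      ext α α'
      by_cases hαα : α = α'
      · subst hαα; simp
      rw [Matrix.diagonal_apply_ne _ hαα]
      by_cases hα : α = β
      · simp only [G, hα, Matrix.of_apply, if_true]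
        exact huv α' fun h' => hαα (hα.trans h'.symm)
      · obtain ⟨D, hD, h1, h2, h3, -⟩ := hF α hα
        simp only [G, hα, Matrix.of_apply, if_false]
        rw [adMatrix_apply (_ - _), trace_aeval_adMatrix_mul, ← hD, map_sub, map_smul, mul_sub,
          mul_smul_comm, map_sub, map_smul, h2, smul_zero, sub_zero]
        by_cases hα' : α' = β
        · simp only [v, hα', if_true]; exact h1
        · simp only [v, hα', if_false, AddSubgroupClass.coe_sub, SetLike.val_smul]
          rw [map_sub, map_smul, mul_sub, mul_smul_comm, map_sub, map_smul, h1,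
            h3 α' hα' (Ne.symm hαα), smul_zero, sub_zero]
    rw [hdiag, Matrix.det_diagonal]
    refine Finset.prod_ne_zero_iff.2 fun α _ => ?_
    by_cases hα : α = β
    · simp only [G, hα, Matrix.of_apply, if_true, v]
      rw [huh]; exact hκ0
    · obtain ⟨D, hD, h1, h2, -, h4⟩ := hF α hα
      simp only [G, hα, Matrix.of_apply, if_false]
      rw [adMatrix_apply (_ - _), trace_aeval_adMatrix_mul, ← hD, map_sub, map_smul, mul_sub,
        mul_smul_comm, map_sub, map_smul, h2, smul_zero, sub_zero]
      simp only [v, hα, if_false, AddSubgroupClass.coe_sub, SetLike.val_smul]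
      rw [map_sub, map_smul, mul_sub, mul_smul_comm, map_sub, map_smul, h1, smul_zero, sub_zero]
      exact h4
  obtain ⟨δ, hδdet, hδ⟩ : ∃ δ, (G δ).det ≠ 0 ∧ 0 < δ := by
    have h1 : ∀ᶠ δ in nhdsWithin (0 : ℝ) (Set.Ioi 0), (G δ).det ≠ 0 :=
      (hGcont.matrix_det.continuousAt.eventually_ne hG0).filter_mono nhdsWithin_le_nhds
    exact (h1.and self_mem_nhdsWithin).exists
  refine dense_linearIndependent_fderiv (fun α z _ => ?_)
    (T.point u (T.degeneratePosition β δ)) (fun α => T.point (v α) 0) ?_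
  · split_ifs
    · exact T.analyticAt_newHamiltonian β b z
    · exact AnalyticAt.comp_polynomial (isInvariantPolynomial_adTrace _).polynomial
        fun ℓ => T.analyticAt_newLax β b ℓ z
  · convert hδdet using 2
    ext α α'
    by_cases hα : α = β
    · simp only [G, hα, Matrix.of_apply, if_true]
      exact T.fderiv_newHamiltonian_degenerate β b δ u (v α')
    · simp only [G, hα, Matrix.of_apply, if_false]
      exact T.fderiv_adTrace_newLax β b (F α) hδ u (v α')

theorem exists_isCompleteInvolutive (hβ : T.a β ≠ 0) :
    ∃ I : ι → PhaseSpace ι → ℝ, IsCompleteInvolutive I ∧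
      ∃ i₀, I i₀ = T.newHamiltonian β b ∧
        ∀ i, i ≠ i₀ → ∃ φ : 𝔤 → ℝ, IsInvariantPolynomial φ ∧ I i = φ ∘ T.newLax β b := by
  classical
  obtain ⟨F, hF⟩ := T.exists_independent β b hβ
  have hcard : Fintype.card ι = Fintype.card T.simple.support := by
    rw [← Module.finrank_eq_card_basis T.h, ← Module.finrank_eq_card_basis T.simple.toWeightBasis,
      Subspace.dual_finrank_eq]
  let σ : ι ≃ T.simple.support := Fintype.equivOfCardEq hcard
  let J : T.simple.support → PhaseSpace ι → ℝ := fun α =>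
    if α = β then T.newHamiltonian β b else adTrace (F α) ∘ T.newLax β b
  have hJβ : J β = T.newHamiltonian β b := if_pos rfl
  have hJ : ∀ α, α ≠ β → J α = adTrace (F α) ∘ T.newLax β b := fun α hα => if_neg hα
  have hinv : ∀ α, IsInvariantPolynomial (adTrace (F α) : 𝔤 → ℝ) :=
    fun α => isInvariantPolynomial_adTrace _
  have hanti : ∀ (A B : PhaseSpace ι → ℝ) z, poisson A B z = -poisson B A z := by
    intro A B z
    rw [poisson, poisson, ← Finset.sum_neg_distrib]
    exact Finset.sum_congr rfl fun i _ => by ring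
  refine ⟨fun i => J (σ i), ⟨fun i => ?_, fun i j z => ?_, ?_⟩, σ.symm β, ?_, fun i hi => ?_⟩
  · by_cases h : σ i = β
    · simp only [h, hJβ]
      exact contDiff_iff_contDiffAt.2 fun z => (T.analyticAt_newHamiltonian β b z).contDiffAt
    · simp only [hJ _ h]
      exact T.contDiff_comp_newLax β b (hinv _)
  · by_cases hi : σ i = β <;> by_cases hj : σ j = β
    · simp only [hi, hj]
      have := hanti (J β) (J β) z
      linarith
    · simp only [hi, hJβ, hJ _ hj]
      exact T.poisson_newHamiltonian_comp_newLax β b hβ (hinv _) z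
    · simp only [hj, hJβ, hJ _ hi]
      rw [hanti, T.poisson_newHamiltonian_comp_newLax β b hβ (hinv _) z, neg_zero]
    · simp only [hJ _ hi, hJ _ hj]
      exact T.poisson_comp_newLax_comp_newLax β b hβ (hinv _) (hinv _) z
  · refine hF.mono fun z hz => ?_
    exact LinearIndependent.comp hz σ σ.injective
  · simp only [Equiv.apply_symm_apply, hJβ]
  · exact ⟨_, hinv _, hJ _ fun h => hi (by rw [← h, Equiv.symm_apply_apply])⟩

/-! ### Changes of time between Toda lattices -/

theorem actionForm_newHamiltonian (z : PhaseSpace ι) (q' : ι → ℝ) (t' : ℝ) :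
    actionForm (T.newHamiltonian β b) z q' (T.expRoot β z * t') =
      actionForm T.hamiltonian z q' t' - b * t' := by
  have := (T.expRoot_pos β z).ne'
  simp only [actionForm, newHamiltonian]
  field_simp
  ring

theorem hamiltonian_withCoupling (E : ℝ) (z : PhaseSpace ι) :
    (T.withCoupling β (T.a β - E)).hamiltonian z =
      -b + T.expRoot β z * (T.newHamiltonian β b z - E) := by
  classical
  have hx := (T.expRoot_pos β z).ne'
  have h1 : (T.withCoupling β (T.a β - E)).hamiltonian z = (1 / 2) *
      killingForm ℝ 𝔤 (T.p z : 𝔤) (T.p z : 𝔤) +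
      ∑ α, Function.update T.a β (T.a β - E) α * T.expRoot α z := by
    simp only [hamiltonian, withCoupling, p, expRoot, q, dualH]
    congr!
  have h2 : ∑ α, Function.update T.a β (T.a β - E) α * T.expRoot α z =
      ∑ α, T.a α * T.expRoot α z - E * T.expRoot β z := by
    rw [T.sum_eq_add_otherRoots β, T.sum_eq_add_otherRoots β, Function.update_self]
    have : ∑ α ∈ T.otherRoots β, Function.update T.a β (T.a β - E) α * T.expRoot α z =
        ∑ α ∈ T.otherRoots β, T.a α * T.expRoot α z :=
      Finset.sum_congr rfl fun α hα => by
        rw [Function.update_of_ne ((T.mem_otherRoots β).1 hα)]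
    rw [this]
    ring
  rw [h1, h2, newHamiltonian, hamiltonian]
  field_simp
  ring

theorem timeChangeMaps_withCoupling (E : ℝ) :
    TimeChangeMaps (T.expRoot β) (T.withCoupling β (T.a β - E)).hamiltonian
      (T.newHamiltonian β b) (-b) E :=
  timeChangeMaps_of_eq_add_mul (fun z => (T.analyticAt_expRoot β z).differentiableAt)
    (T.expRoot_pos β) (fun z => (T.analyticAt_newHamiltonian β b z).differentiableAt)
    (T.hamiltonian_withCoupling β b E)

theorem timeChangeMaps_hamiltonian :
    TimeChangeMaps (T.expRoot β) T.hamiltonian (T.newHamiltonian β b) (-b) 0 := by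
  refine timeChangeMaps_of_eq_add_mul (fun z => (T.analyticAt_expRoot β z).differentiableAt)
    (T.expRoot_pos β) (fun z => (T.analyticAt_newHamiltonian β b z).differentiableAt) fun z => ?_
  have := (T.expRoot_pos β z).ne'
  rw [newHamiltonian]
  field_simp
  ring

end TodaLattice

end

theorem mainTheorem1 {𝔤 : Type*} [LieRing 𝔤] [LieAlgebra ℝ 𝔤] [FiniteDimensional ℝ 𝔤]
    [LieAlgebra.IsSimple ℝ 𝔤] {𝔞 : LieSubalgebra ℝ 𝔤} [𝔞.IsCartanSubalgebra]
    [LieModule.IsTriangularizable ℝ 𝔞 𝔤] {ι : Type*} [Fintype ι] [DecidableEq ι]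
    (T : TodaLattice 𝔞 ι) (β : T.simple.support) (hβ : T.a β ≠ 0) (b : ℝ) :
    -- the canonical form `p dq - H dt` is preserved up to the exact form `b dt`
    (∀ (z : PhaseSpace ι) (q' : ι → ℝ) (t' : ℝ),
      actionForm (T.newHamiltonian β b) z q' (T.expRoot β z * t') =
        actionForm T.hamiltonian z q' t' - b * t') ∧
    -- the time change carries the Toda trajectories on `H = -b` to those of `H̃` on `H̃ = 0`
    TimeChangeMaps (T.expRoot β) T.hamiltonian (T.newHamiltonian β b) (-b) 0 ∧
    -- and likewise on every other level `H̃ = E`, on shifting `a_β` by `E`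
    (∀ E : ℝ, TimeChangeMaps (T.expRoot β) (T.withCoupling β (T.a β - E)).hamiltonian
      (T.newHamiltonian β b) (-b) E) ∧
    -- the new system is integrable, its further integrals being restrictions of invariants
    (∃ I : ι → PhaseSpace ι → ℝ, IsCompleteInvolutive I ∧
      ∃ i₀, I i₀ = T.newHamiltonian β b ∧
        ∀ i, i ≠ i₀ → ∃ φ : 𝔤 → ℝ, IsInvariantPolynomial φ ∧ I i = φ ∘ T.newLax β b) ∧
    -- the new Lax equation
    (∀ z, poissonVec (T.newHamiltonian β b) (T.newLax β b) z =
      ⁅T.newLax β b z, T.newLaxMinus β z⁆) ∧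
    -- the restrictions of all invariant polynomials are integrals of motion in involution
    (∀ φ : 𝔤 → ℝ, IsInvariantPolynomial φ → ContDiff ℝ ∞ (φ ∘ T.newLax β b) ∧
      ∀ z, poisson (T.newHamiltonian β b) (φ ∘ T.newLax β b) z = 0) ∧
    (∀ φ ψ : 𝔤 → ℝ, IsInvariantPolynomial φ → IsInvariantPolynomial ψ →
      ∀ z, poisson (φ ∘ T.newLax β b) (ψ ∘ T.newLax β b) z = 0) := by
  exact ⟨T.actionForm_newHamiltonian β b, T.timeChangeMaps_hamiltonian β b,
    T.timeChangeMaps_withCoupling β b, T.exists_isCompleteInvolutive β b hβ,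
    T.poissonVec_newHamiltonian_newLax β b hβ,
    fun φ hφ => ⟨T.contDiff_comp_newLax β b hφ, T.poisson_newHamiltonian_comp_newLax β b hβ hφ⟩,
    fun φ ψ hφ hψ => T.poisson_comp_newLax_comp_newLax β b hβ hφ hψ⟩
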